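/- Let $\lambda,q\ge 0$ and $N\ge 1$ be integers and let $\delta\ge 1$ be a real number. Let $H:\{0,1\}^*\to\{0,1\}^\lambda$ be a random oracle, i.e. the values $H(x)$, $x\in\{0,1\}^*$, are independent and uniformly distributed on $\{0,1\}^\lambda$. Consider a quantum adversary in the parallel quantum random oracle model that makes at most $q$ queries in total, spread over $N-1$ rounds. That is, the adversary works on a finite-dimensional Hilbert space with orthonormal computational basis $|(x_1,y_1),\dots,(x_q,y_q),z\rangle$, where each $x_j$ ranges over an arbitrary finite set $S\subset\{0,1\}^*$ of strings that fit in the input registers, each $y_j$ ranges over $\{0,1\}^\lambda$, and the private storage $z$ ranges over an arbitrary finite set. It starts in an arbitrary unit vector independent of $H$. In round $i\in\{1,\dots,N-1\}$ it submits a batch of $k_i\ge 0$ parallel queries, which act on the first $k_i$ query slots by $$|(x_1,y_1),\dots,(x_{k_i},y_{k_i}),\dots\rangle\mapsto|(x_1,y_1\oplus H(x_1)),\dots,(x_{k_i},y_{k_i}\oplus H(x_{k_i})),\dots\rangle ,$$ and then applies an arbitrary unitary $U_i$, independent of $H$, to all of its registers; the numbers $k_i$ are fixed in advance and satisfy $\sum_{i=1}^{N-1}k_i\le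 q$. After the last round all registers are measured in the computational basis, and the output is a function of the measured basis label. Let $p$ be the probability, over $H$ and the measurement, that the adversary outputs pairs $(x_0,y_0),\dots,(x_{N-1},y_{N-1})\in\{0,1\}^*\times\{0,1\}^\lambda$ and a string $x_N\in\{0,1\}^*$ such that $|x_i|\le\delta\lambda$ for all $0\le i\le N$, $y_i=H(x_i)$ for all $0\le i\le N-1$, and $y_{i-1}$ is a substring of $x_i$ for all $1\le i\le N$, i.e. $x_i=a\,\|\,y_{i-1}\,\|\,b$ for some $a,b\in\{0,1\}^*$ (so that $x_0,\dots,x_N$ is an $H$-sequence of length $N$). Then $$p\le\frac{64\,q^3\,\delta\lambda}{2^\lambda}+\frac{2N}{2^\lambda}.$$ -/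

import Mathlib

open MeasureTheory

namespace PQROM

/-- Bit strings of length `lam`. -/
abbrev Bits (lam : ℕ) : Type := Fin lam → Bool

/-- A hash function from bit strings of arbitrary finite length to `lam`-bit strings. -/
abbrev HashFun (lam : ℕ) : Type := List Bool → Bits lam

/-- Bitwise exclusive or. -/
def bxor {lam : ℕ} (y h : Bits lam) : Bits lam := fun i => Bool.xor (y i) (h i)

/-- `Substring u v`: the string `u` is a contiguous substring of the string `v`. -/
def Substring (u v : List Bool) : Prop := ∃ a b : List Bool, v = a ++ u ++ b

/-- The law of the random oracle: the values on distinct input strings are independent and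
uniformly distributed on `lam`-bit strings. -/
noncomputable def randomOracle (lam : ℕ) : Measure (HashFun lam) :=
  Measure.infinitePi fun _ : List Bool => (PMF.uniformOfFintype (Bits lam)).toMeasure

instance (lam : ℕ) : IsProbabilityMeasure (randomOracle lam) := by
  unfold randomOracle; infer_instance

/-- Labels of the computational basis `|(x₁, y₁), …, (x_q, y_q), z⟩` of the adversary's registers:
`q` query slots, each with an input string (an element of the finite set `S` of strings that fit
into the input register) and a `lam`-bit response register, and a private storage `z`. -/
abbrev Basis (lam q : ℕ) (S : Finset (List Bool)) (Z : Type*) : Type _ :=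
  (Fin q → S × Bits lam) × Z

/-- Finite-dimensional Hilbert space of the adversary's registers. -/
abbrev StateSpace (lam q : ℕ) (S : Finset (List Bool)) (Z : Type*) : Type _ :=
  EuclideanSpace ℂ (Basis lam q S Z)

section Oracle

variable {lam q : ℕ} {S : Finset (List Bool)} {Z : Type*}

/-- A batch of `k` parallel queries on basis labels: each of the first `k` slots `(x, y)` becomes
`(x, y ⊕ H x)`, and everything else is left unchanged. -/
def queryBasis (H : HashFun lam) (k : ℕ) (b : Basis lam q S Z) : Basis lam q S Z :=
  (fun j => if (j : ℕ) < k then ((b.1 j).1, bxor (b.1 j).2 (H (b.1 j).1)) else b.1 j, b.2)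

theorem queryBasis_involutive (H : HashFun lam) (k : ℕ) :
    Function.Involutive (queryBasis (q := q) (S := S) (Z := Z) H k) := by
  rintro ⟨s, z⟩
  refine Prod.ext (funext fun j => ?_) rfl
  by_cases h : (j : ℕ) < k
  · refine Prod.ext ?_ (funext fun i => ?_) <;> simp [queryBasis, h, bxor]
  · simp [queryBasis, h]

/-- The unitary performing `k` parallel (standard) oracle queries: it maps each basis vector `|b⟩`
to `|queryBasis H k b⟩`. -/
noncomputable def parallelQuery [Fintype Z] (H : HashFun lam) (k : ℕ) :
    StateSpace lam q S Z ≃ₗᵢ[ℂ] StateSpace lam q S Z :=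
  LinearIsometryEquiv.piLpCongrLeft 2 ℂ ℂ (queryBasis_involutive H k).toPerm

theorem parallelQuery_apply [Fintype Z] (H : HashFun lam) (k : ℕ) (ψ : StateSpace lam q S Z)
    (b : Basis lam q S Z) : parallelQuery H k ψ b = ψ (queryBasis H k b) := by
  rw [parallelQuery, LinearIsometryEquiv.piLpCongrLeft_apply]
  simp [Equiv.piCongrLeft']

theorem measurableSet_queryBasis_eq (k : ℕ) (b b' : Basis lam q S Z) :
    MeasurableSet {H : HashFun lam | queryBasis H k b = b'} := by
  let g : HashFun lam → (Fin q → Bits lam) := fun H j => H (b.1 j).1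
  let T : Set (Fin q → Bits lam) := {v | ((fun j => if (j : ℕ) < k then
    ((b.1 j).1, bxor (b.1 j).2 (v j)) else b.1 j, b.2) : Basis lam q S Z) = b'}
  have hg : Measurable g := measurable_pi_lambda _ fun j => measurable_pi_apply _
  exact hg (T.toFinite.measurableSet : MeasurableSet T)

theorem measurable_parallelQuery [Fintype Z] (k : ℕ) {ψ : HashFun lam → StateSpace lam q S Z}
    (hψ : Measurable ψ) : Measurable fun H => parallelQuery H k (ψ H) := by
  classical
  have hc : ∀ b : Basis lam q S Z, Measurable fun φ : StateSpace lam q S Z => φ b := fun b =>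
    (EuclideanSpace.proj (𝕜 := ℂ) b).continuous.measurable
  have key : Measurable fun H => (fun b => parallelQuery H k (ψ H) b : Basis lam q S Z → ℂ) := by
    refine measurable_pi_lambda _ fun b => ?_
    have : (fun H => parallelQuery H k (ψ H) b) =
        fun H => ∑ b' : Basis lam q S Z, if queryBasis H k b = b' then ψ H b' else 0 := by
      funext H
      simp [parallelQuery_apply]
    rw [this]
    exact Finset.measurable_sum _ fun b' _ =>
      Measurable.ite (measurableSet_queryBasis_eq k b b') ((hc b').comp hψ) measurable_const
  exact (PiLp.continuous_toLp 2 _).measurable.comp key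

end Oracle

/-- A quantum adversary in the parallel quantum random oracle model with output in `Out`, which
makes at most `q` queries in total, spread over `rounds` rounds. In round `i` it submits a batch of
`width i` parallel queries and then applies the unitary `U i` to all of its registers. After the
last round the registers are measured in the computational basis and the output is read off from
the measured label. -/
structure Adversary (lam q rounds : ℕ) (S : Finset (List Bool)) (Z : Type*) [Fintype Z]
    (Out : Type*) where
  init : StateSpace lam q S Z
  norm_init : ‖init‖ = 1
  width : Fin rounds → ℕ
  total_width_le : ∑ i, width i ≤ q
  U : Fin rounds → (StateSpace lam q S Z ≃ₗᵢ[ℂ] StateSpace lam q S Z)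
  out : Basis lam q S Z → Out

namespace Adversary

variable {lam q rounds : ℕ} {S : Finset (List Bool)} {Z : Type*} [Fintype Z] {Out : Type*}

/-- The state before the final measurement when the oracle is `H`. -/
noncomputable def finalState (A : Adversary lam q rounds S Z Out) (H : HashFun lam) :
    StateSpace lam q S Z :=
  Fin.foldl rounds (fun ψ i => A.U i (parallelQuery H (A.width i) ψ)) A.init

open Classical in
/-- The probability, for a fixed oracle `H`, that the output lies in `E`. -/
noncomputable def outputProb (A : Adversary lam q rounds S Z Out) (H : HashFun lam)
    (E : Set Out) : ℝ :=
  ∑ b : Basis lam q S Z, if A.out b ∈ E then ‖A.finalState H b‖ ^ 2 else 0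

/-- The probability, over a random oracle `H` and the final measurement, that the output lies in
the (oracle dependent) set `E H`. -/
noncomputable def successProb (A : Adversary lam q rounds S Z Out)
    (E : HashFun lam → Set Out) : ℝ :=
  ∫ H, A.outputProb H (E H) ∂(randomOracle lam)

theorem measurable_finalState (A : Adversary lam q rounds S Z Out) : Measurable A.finalState := by
  have key : ∀ (n : ℕ) (w : Fin n → ℕ)
      (U : Fin n → (StateSpace lam q S Z ≃ₗᵢ[ℂ] StateSpace lam q S Z)),
      Measurable fun H : HashFun lam =>
        Fin.foldl n (fun ψ i => U i (parallelQuery H (w i) ψ)) A.init := by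
    intro n
    induction n with
    | zero => intro w U; simp
    | succ n ih =>
      intro w U
      simp only [Fin.foldl_succ_last]
      exact (U (Fin.last n)).continuous.measurable.comp
        (measurable_parallelQuery _ (ih (fun i => w i.castSucc) (fun i => U i.castSucc)))
  exact key rounds A.width A.U

theorem norm_finalState (A : Adversary lam q rounds S Z Out) (H : HashFun lam) :
    ‖A.finalState H‖ = 1 := by
  have key : ∀ (n : ℕ) (w : Fin n → ℕ)
      (U : Fin n → (StateSpace lam q S Z ≃ₗᵢ[ℂ] StateSpace lam q S Z)),
      ‖Fin.foldl n (fun ψ i => U i (parallelQuery H (w i) ψ)) A.init‖ = 1 := by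
    intro n
    induction n with
    | zero => intro w U; simpa using A.norm_init
    | succ n ih =>
      intro w U
      simp only [Fin.foldl_succ_last, LinearIsometryEquiv.norm_map]
      exact ih (fun i => w i.castSucc) (fun i => U i.castSucc)
  exact key rounds A.width A.U

/-- The integral defining `successProb` is a genuine one for every measurable event. -/
theorem integrable_outputProb (A : Adversary lam q rounds S Z Out) (E : HashFun lam → Set Out)
    (hE : ∀ o, MeasurableSet {H | o ∈ E H}) :
    Integrable (fun H => A.outputProb H (E H)) (randomOracle lam) := by
  classical
  have hc : ∀ b : Basis lam q S Z, Measurable fun φ : StateSpace lam q S Z => φ b := fun b =>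
    (EuclideanSpace.proj (𝕜 := ℂ) b).continuous.measurable
  unfold outputProb
  refine integrable_finsetSum _ fun b _ => ?_
  refine Integrable.of_bound (C := 1) (Measurable.aestronglyMeasurable ?_)
    (Filter.Eventually.of_forall fun H => ?_)
  · exact Measurable.ite (hE (A.out b))
      (((hc b).comp A.measurable_finalState).norm.pow_const 2) measurable_const
  · have h1 : ‖A.finalState H b‖ ≤ 1 :=
      (PiLp.norm_apply_le (A.finalState H) b).trans (A.norm_finalState H).le
    have h0 := norm_nonneg (A.finalState H b)
    split_ifs
    · rw [Real.norm_of_nonneg (by positivity)]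
      nlinarith
    · simp

end Adversary

/-- The winning outputs `(x₀, …, x_N)`, `(y₀, …, y_{N-1})` relative to `H`: each `x i` has length at
most `δ * lam`, each `y i` is the hash of `x i`, and each `y i` is a substring of `x (i + 1)`. -/
def HSeqOutputs (lam N : ℕ) (δ : ℝ) (H : HashFun lam) :
    Set ((Fin (N + 1) → List Bool) × (Fin N → Bits lam)) :=
  {o | (∀ i, ((o.1 i).length : ℝ) ≤ δ * lam) ∧
       (∀ i : Fin N, o.2 i = H (o.1 i.castSucc)) ∧
       (∀ i : Fin N, Substring (List.ofFn (o.2 i)) (o.1 i.succ))}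

theorem measurableSet_HSeqOutputs (lam N : ℕ) (δ : ℝ)
    (o : (Fin (N + 1) → List Bool) × (Fin N → Bits lam)) :
    MeasurableSet {H : HashFun lam | o ∈ HSeqOutputs lam N δ H} := by
  have h : ∀ i : Fin N, MeasurableSet {H : HashFun lam | o.2 i = H (o.1 i.castSucc)} := fun i =>
    measurableSet_eq_fun measurable_const (measurable_pi_apply _)
  exact (MeasurableSet.const _).inter
    ((by simpa only [Set.ofPred_forall] using MeasurableSet.iInter h :
      MeasurableSet {H : HashFun lam | ∀ i : Fin N, o.2 i = H (o.1 i.castSucc)}).inter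
      (MeasurableSet.const _))

end PQROM

/-! The proof is a compressed-oracle argument. On the finitely many strings that can be queried or
output, the random oracle is replaced by a register in uniform superposition over all functions.
Each coordinate gets an extra symbol ⊥ (`none`), and the reflection along |⊥⟩ − |φ₀⟩ exchanges ⊥
with the uniform state φ₀. Performed in all coordinates (`fullRefl`), it turns the initial oracle
into the empty database and a query into reflect–query–reflect in the queried coordinate alone
(`multiRefl_slotQuery`). Hence s queries create at most s database entries.

Join a hash value y to a string x if y occurs in x and |x| ≤ δλ; each x receives at most m = ⌊δλ⌋
values. Up to a small amplitude, a round lengthens the longest walk in the database by at most one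
string. Indeed, a new entry is harmful only if its value lies in `reach`, the values with an edge to
a string of the database or of the current batch (`BatchBad.exists_mem_reach`). These are at most qm
of the 2^λ values, so one query contributes amplitude at most 2√(2qm/2^λ)
(`nrm_indicator_compQuery_le`). A batch is processed slot by slot; the property `BatchBad`
interpolates between walks through r + 1 strings before it and walks through r + 2 strings after it.
Amplitudes add over at most q queries, so after N − 1 rounds walks through N strings have squared
amplitude a² ≤ 4q² · 2qm/2^λ = 8q³m/2^λ.

A winning output describes such a walk in the uncompressed oracle. Passing to the compressed one
changes the amplitude of k prescribed values by at most √(k/2^λ) (`nrm_indicator_sub_multiRefl_le`).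
Since (u + v)² ≤ 2u² + 2v², p ≤ 2a² + 2N/2^λ, which is within the claim with 16 in place of 64. -/

set_option linter.unusedSectionVars false

namespace PQROM

/-! ### Norms of amplitude functions -/

section L2

variable {α γ : Type*} [Fintype α] [Fintype γ]

/-- The `ℓ²` norm of a complex function on a finite type. -/
noncomputable def nrm (f : α → ℂ) : ℝ := ‖(WithLp.toLp 2 f : EuclideanSpace ℂ α)‖

theorem nrm_nonneg (f : α → ℂ) : 0 ≤ nrm f := norm_nonneg _

theorem nrm_sq (f : α → ℂ) : nrm f ^ 2 = ∑ a, ‖f a‖ ^ 2 := EuclideanSpace.norm_sq_eq _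

theorem nrm_add_le (f g : α → ℂ) : nrm (f + g) ≤ nrm f + nrm g := by
  simpa [nrm] using norm_add_le (WithLp.toLp 2 f : EuclideanSpace ℂ α) (WithLp.toLp 2 g)

theorem nrm_le_mul_of_sum_le {f : α → ℂ} {g : γ → ℂ} {c : ℝ} (hc : 0 ≤ c)
    (h : ∑ a, ‖f a‖ ^ 2 ≤ c ^ 2 * ∑ a, ‖g a‖ ^ 2) : nrm f ≤ c * nrm g := by
  refine le_of_sq_le_sq ?_ (mul_nonneg hc (nrm_nonneg g))
  rwa [mul_pow, nrm_sq, nrm_sq]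

theorem nrm_eq_of_sum_eq {f : α → ℂ} {g : γ → ℂ} (h : ∑ a, ‖f a‖ ^ 2 = ∑ a, ‖g a‖ ^ 2) :
    nrm f = nrm g := by
  rw [← nrm_sq, ← nrm_sq] at h
  exact (sq_eq_sq₀ (nrm_nonneg f) (nrm_nonneg g)).1 h

theorem nrm_le_of_norm_le {f g : α → ℂ} (h : ∀ a, ‖f a‖ ≤ ‖g a‖) : nrm f ≤ nrm g := by
  have := nrm_le_mul_of_sum_le (f := f) (g := g) zero_le_one (by
    rw [one_pow, one_mul]
    exact Finset.sum_le_sum fun a _ => by gcongr; exact h a)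
  simpa using this

theorem nrm_indicator_le (s : Set α) (f : α → ℂ) : nrm (s.indicator f) ≤ nrm f :=
  nrm_le_of_norm_le fun _ => norm_indicator_le_norm_self _ _

theorem nrm_neg (f : α → ℂ) : nrm (-f) = nrm f := nrm_eq_of_sum_eq (by simp)

theorem nrm_comp_perm (e : Equiv.Perm α) (f : α → ℂ) : nrm (f ∘ e) = nrm f :=
  nrm_eq_of_sum_eq (Equiv.sum_comp e fun a => ‖f a‖ ^ 2)

end L2

/-! ### Reflections in single database coordinates and their products -/

section Site

variable {I Y : Type*} [Fintype I] [DecidableEq I] [Fintype Y]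

/-- Exchanging `a` with the entry at `x` is an involution of the pairs `(D, a)`. This reduces
inequalities of sums to single fibres. -/
theorem sum_sum_update {A : Type*} [Fintype A] (x : I) (F : (I → A) → ℝ) :
    ∑ D, ∑ a, F (Function.update D x a) = Fintype.card A * ∑ D, F D := by
  have hinv : Function.Involutive
      fun p : (I → A) × A => (Function.update p.1 x p.2, p.1 x) := by
    rintro ⟨D, a⟩
    simp
  have := Equiv.sum_comp hinv.toPerm (fun p : (I → A) × A => F p.1)
  simp only [Function.Involutive.coe_toPerm, Fintype.sum_prod_type] at this
  rw [this]
  simp [Finset.mul_sum]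

theorem sum_le_sum_of_fiber_le {A : Type*} [Fintype A] [Nonempty A] (x : I)
    {F G : (I → A) → ℝ}
    (h : ∀ D, ∑ a, F (Function.update D x a) ≤ ∑ a, G (Function.update D x a)) :
    ∑ D, F D ≤ ∑ D, G D := by
  have h1 := Finset.sum_le_sum fun D (_ : D ∈ Finset.univ) => h D
  rw [sum_sum_update, sum_sum_update] at h1
  exact le_of_mul_le_mul_left h1 (by exact_mod_cast Fintype.card_pos)

/-- The vector `|⊥⟩ - |φ₀⟩` with `φ₀` the uniform superposition; the reflection along it
exchanges `|⊥⟩` and `|φ₀⟩`. -/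
noncomputable def reflVec (Y : Type*) [Fintype Y] : Option Y → ℝ
  | none => 1
  | some _ => -(√(Fintype.card Y))⁻¹

@[simp] theorem reflVec_none : reflVec Y none = 1 := rfl

@[simp] theorem reflVec_some (y : Y) : reflVec Y (some y) = -(√(Fintype.card Y))⁻¹ := rfl

theorem sum_reflVec_sq [Nonempty Y] : ∑ a, reflVec Y a ^ 2 = 2 := by
  have : (Fintype.card Y : ℝ) ≠ 0 := by exact_mod_cast Fintype.card_ne_zero
  rw [Fintype.sum_option]
  simp [this]
  norm_num

/-- Overlap of `f` with `reflVec` in the coordinate `x`. -/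
noncomputable def siteAmp (x : I) (f : (I → Option Y) → ℂ) (D : I → Option Y) : ℂ :=
  ∑ a, (reflVec Y a : ℂ) * f (Function.update D x a)

/-- The reflection exchanging `|⊥⟩` and the uniform superposition in the coordinate `x`. -/
noncomputable def siteRefl (x : I) (f : (I → Option Y) → ℂ) (D : I → Option Y) : ℂ :=
  f D - reflVec Y (D x) * siteAmp x f D

@[simp] theorem siteAmp_update (x : I) (f : (I → Option Y) → ℂ) (D : I → Option Y)
    (a : Option Y) : siteAmp x f (Function.update D x a) = siteAmp x f D := by
  simp [siteAmp]

theorem siteRefl_update (x : I) (f : (I → Option Y) → ℂ) (D : I → Option Y) (a : Option Y) :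
    siteRefl x f (Function.update D x a) =
      f (Function.update D x a) - reflVec Y a * siteAmp x f D := by
  simp [siteRefl]

theorem siteAmp_siteRefl [Nonempty Y] (x : I) (f : (I → Option Y) → ℂ) (D : I → Option Y) :
    siteAmp x (siteRefl x f) D = -siteAmp x f D := by
  have h2 : ∑ a, (reflVec Y a : ℂ) ^ 2 = 2 := by exact_mod_cast sum_reflVec_sq (Y := Y)
  rw [siteAmp]
  simp only [siteRefl_update, mul_sub, Finset.sum_sub_distrib]
  rw [← siteAmp, show ∑ a, (reflVec Y a : ℂ) * (reflVec Y a * siteAmp x f D) =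
    (∑ a, (reflVec Y a : ℂ) ^ 2) * siteAmp x f D by
      rw [Finset.sum_mul]; exact Finset.sum_congr rfl fun a _ => by ring, h2]
  ring

theorem siteRefl_siteRefl [Nonempty Y] (x : I) (f : (I → Option Y) → ℂ) :
    siteRefl x (siteRefl x f) = f := by
  funext D
  rw [siteRefl, siteAmp_siteRefl, siteRefl]
  ring

theorem norm_siteAmp_sq_le [Nonempty Y] (x : I) (f : (I → Option Y) → ℂ) (D : I → Option Y) :
    ‖siteAmp x f D‖ ^ 2 ≤ 2 * ∑ a, ‖f (Function.update D x a)‖ ^ 2 := by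
  have h1 : ‖siteAmp x f D‖ ≤ ∑ a, |reflVec Y a| * ‖f (Function.update D x a)‖ := by
    refine (norm_sum_le _ _).trans (Finset.sum_le_sum fun a _ => ?_)
    rw [norm_mul, Complex.norm_real, Real.norm_eq_abs]
  calc ‖siteAmp x f D‖ ^ 2 ≤ (∑ a, |reflVec Y a| * ‖f (Function.update D x a)‖) ^ 2 := by gcongr
    _ ≤ (∑ a, |reflVec Y a| ^ 2) * ∑ a, ‖f (Function.update D x a)‖ ^ 2 :=
      Finset.sum_mul_sq_le_sq_mul_sq _ _ _
    _ = _ := by simp only [sq_abs, sum_reflVec_sq]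

/-- The cross term removes 2‖s‖², and the rank-one term restores it because `reflVec` has squared
norm 2. -/
theorem sum_norm_siteRefl_fiber [Nonempty Y] (x : I) (f : (I → Option Y) → ℂ)
    (D : I → Option Y) :
    ∑ a, ‖siteRefl x f (Function.update D x a)‖ ^ 2 = ∑ a, ‖f (Function.update D x a)‖ ^ 2 := by
  set s := siteAmp x f D with hs
  have h1 : ∀ a, ‖siteRefl x f (Function.update D x a)‖ ^ 2 =
      ‖f (Function.update D x a)‖ ^ 2 - 2 * ((reflVec Y a * f (Function.update D x a)) *
        (starRingEnd ℂ) s).re + reflVec Y a ^ 2 * ‖s‖ ^ 2 := by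
    intro a
    rw [siteRefl_update, ← hs, ← Complex.normSq_eq_norm_sq, Complex.normSq_sub,
      Complex.normSq_mul, Complex.normSq_ofReal, Complex.normSq_eq_norm_sq,
      Complex.normSq_eq_norm_sq, map_mul, Complex.conj_ofReal]
    ring_nf
  simp only [h1, Finset.sum_add_distrib, Finset.sum_sub_distrib]
  rw [← Finset.mul_sum, ← Finset.sum_mul, sum_reflVec_sq, ← Complex.re_sum, ← Finset.sum_mul,
    ← siteAmp, ← hs, Complex.mul_conj, Complex.normSq_eq_norm_sq, Complex.ofReal_re]
  ring

theorem sum_norm_siteRefl [Nonempty Y] (x : I) (f : (I → Option Y) → ℂ) :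
    ∑ D, ‖siteRefl x f D‖ ^ 2 = ∑ D, ‖f D‖ ^ 2 :=
  le_antisymm (sum_le_sum_of_fiber_le x fun D => (sum_norm_siteRefl_fiber x f D).le)
    (sum_le_sum_of_fiber_le x fun D => (sum_norm_siteRefl_fiber x f D).ge)

theorem nrm_siteRefl [Nonempty Y] (x : I) (f : (I → Option Y) → ℂ) :
    nrm (siteRefl x f) = nrm f := nrm_eq_of_sum_eq (sum_norm_siteRefl x f)

theorem siteRefl_comm (x z : I) (f : (I → Option Y) → ℂ) :
    siteRefl x (siteRefl z f) = siteRefl z (siteRefl x f) := by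
  rcases eq_or_ne x z with rfl | h
  · rfl
  have key : ∀ {x z : I}, x ≠ z → ∀ D, siteAmp x (siteRefl z f) D =
      siteAmp x f D - reflVec Y (D z) * ∑ a, ∑ c, (reflVec Y a : ℂ) * (reflVec Y c *
        f (Function.update (Function.update D x a) z c)) := by
    intro x z h D
    simp only [siteAmp, siteRefl, mul_sub, Finset.sum_sub_distrib,
      Function.update_of_ne h.symm, Finset.mul_sum]
    congr 1
    exact Finset.sum_congr rfl fun a _ => Finset.sum_congr rfl fun c _ => by ring
  funext D
  rw [siteRefl, siteRefl, siteRefl, siteRefl, key h, key h.symm,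
    Finset.sum_comm (s := (Finset.univ : Finset (Option Y)))]
  have : ∑ c, ∑ a, (reflVec Y a : ℂ) * (reflVec Y c *
        f (Function.update (Function.update D x a) z c)) =
      ∑ c, ∑ a, (reflVec Y c : ℂ) * (reflVec Y a *
        f (Function.update (Function.update D z c) x a)) :=
    Finset.sum_congr rfl fun a _ => Finset.sum_congr rfl fun c _ => by
      rw [Function.update_comm h]; ring
  rw [this]
  ring

instance : LeftCommutative (siteRefl : I → ((I → Option Y) → ℂ) → (I → Option Y) → ℂ) :=
  ⟨siteRefl_comm⟩

/-- The reflections `siteRefl x` applied in all coordinates `x ∈ X`. -/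
noncomputable def multiRefl (X : Finset I) (f : (I → Option Y) → ℂ) : (I → Option Y) → ℂ :=
  X.val.foldr siteRefl f

@[simp] theorem multiRefl_empty (f : (I → Option Y) → ℂ) : multiRefl ∅ f = f := rfl

theorem multiRefl_insert {x : I} {X : Finset I} (h : x ∉ X) (f : (I → Option Y) → ℂ) :
    multiRefl (insert x X) f = siteRefl x (multiRefl X f) := by
  rw [multiRefl, Finset.insert_val_of_notMem h, Multiset.foldr_cons, multiRefl]

theorem multiRefl_insert' {x : I} {X : Finset I} (h : x ∉ X) (f : (I → Option Y) → ℂ) :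
    multiRefl (insert x X) f = multiRefl X (siteRefl x f) := by
  rw [multiRefl_insert h]
  clear h
  induction X using Finset.induction_on with
  | empty => rfl
  | insert z X hz ih => rw [multiRefl_insert hz, multiRefl_insert hz, siteRefl_comm, ih]

theorem multiRefl_union {X X' : Finset I} (h : Disjoint X X') (f : (I → Option Y) → ℂ) :
    multiRefl (X ∪ X') f = multiRefl X (multiRefl X' f) := by
  induction X using Finset.induction_on with
  | empty => simp
  | insert z X hz ih =>
    rw [Finset.disjoint_insert_left] at h
    rw [Finset.insert_union, multiRefl_insert (by simp [hz, h.1]), multiRefl_insert hz, ih h.2]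

theorem nrm_multiRefl [Nonempty Y] (X : Finset I) (f : (I → Option Y) → ℂ) :
    nrm (multiRefl X f) = nrm f := by
  induction X using Finset.induction_on with
  | empty => rfl
  | insert z X hz ih => rw [multiRefl_insert hz, nrm_siteRefl, ih]

/-- `multiRefl X` treats functions of the coordinates outside `X` as constants. -/
theorem multiRefl_param {A : Type*} (X : Finset I) (π : (I → Option Y) → A)
    (hπ : ∀ x ∈ X, ∀ D a, π (Function.update D x a) = π D) (g : A → (I → Option Y) → ℂ)
    (D : I → Option Y) :
    multiRefl X (fun D' => g (π D') D') D = multiRefl X (g (π D)) D := by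
  induction X using Finset.induction_on generalizing D with
  | empty => rfl
  | insert z X hz ih =>
    have ih' := ih fun x hx => hπ x (Finset.mem_insert_of_mem hx)
    rw [multiRefl_insert hz, multiRefl_insert hz]
    simp only [siteRefl, siteAmp, ih', hπ z (Finset.mem_insert_self z X)]

/-- Membership in `s` is constant along the fibres on which the reflections act. -/
theorem multiRefl_indicator (X : Finset I) (s : Set (I → Option Y))
    (hs : ∀ x ∈ X, ∀ D a, Function.update D x a ∈ s ↔ D ∈ s) (f : (I → Option Y) → ℂ) :
    multiRefl X (s.indicator f) = s.indicator (multiRefl X f) := by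
  classical
  funext D
  have h := multiRefl_param X (fun D => D ∈ s) (fun x hx D a => propext (hs x hx D a))
    (fun p D => if p then f D else 0) D
  have e : s.indicator f = fun D => if D ∈ s then f D else 0 := by
    funext D; rw [Set.indicator_apply]
  rw [e, h]
  by_cases hD : D ∈ s
  · simp [hD]
  · have h0 : multiRefl X (fun _ : I → Option Y => (0 : ℂ)) = fun _ => 0 := by
      clear h hs
      induction X using Finset.induction_on with
      | empty => rfl
      | insert z X hz ih => rw [multiRefl_insert hz, ih]; funext D; simp [siteRefl, siteAmp]
    simp [hD, h0]

end Site

/-! ### Compressed queries and the amplitude of one transition -/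

section Slot

variable {I Y β : Type*} [Fintype I] [DecidableEq I] [Fintype Y] [Fintype β]

/-- The reflection in the coordinate `xx b` that is selected by the basis label `b`. -/
noncomputable def slotRefl (xx : β → I) (f : (I → Option Y) × β → ℂ)
    (p : (I → Option Y) × β) : ℂ := siteRefl (xx p.2) (fun D => f (D, p.2)) p.1

/-- The part of `slotRefl` that differs from the identity. -/
noncomputable def slotDefect (xx : β → I) (f : (I → Option Y) × β → ℂ)
    (p : (I → Option Y) × β) : ℂ :=
  reflVec Y (p.1 (xx p.2)) * siteAmp (xx p.2) (fun D => f (D, p.2)) p.1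

/-- A query on basis labels: `sx a` acts on the label when the database entry at `xx b` is `a`. -/
def slotQuery (xx : β → I) (sx : Option Y → β → β) (f : (I → Option Y) × β → ℂ)
    (p : (I → Option Y) × β) : ℂ := f (p.1, sx (p.1 (xx p.2)) p.2)

/-- The compressed version of `slotQuery`. -/
noncomputable def compQuery (xx : β → I) (sx : Option Y → β → β)
    (f : (I → Option Y) × β → ℂ) : (I → Option Y) × β → ℂ :=
  slotRefl xx (slotQuery xx sx (slotRefl xx f))

theorem slotRefl_eq (xx : β → I) (f : (I → Option Y) × β → ℂ) :
    slotRefl xx f = f + -slotDefect xx f := by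
  funext p; simp [slotRefl, siteRefl, slotDefect, sub_eq_add_neg]

theorem nrm_slotRefl [Nonempty Y] (xx : β → I) (f : (I → Option Y) × β → ℂ) :
    nrm (slotRefl xx f) = nrm f := by
  refine nrm_eq_of_sum_eq ?_
  rw [Fintype.sum_prod_type_right, Fintype.sum_prod_type_right]
  exact Finset.sum_congr rfl fun b _ => sum_norm_siteRefl (xx b) fun D => f (D, b)

variable {xx : β → I} {sx : Option Y → β → β}

theorem nrm_slotQuery (hsx : ∀ a b, sx a (sx a b) = b) (hxx : ∀ a b, xx (sx a b) = xx b)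
    (f : (I → Option Y) × β → ℂ) : nrm (slotQuery xx sx f) = nrm f := by
  have hinv : Function.Involutive fun p : (I → Option Y) × β =>
      (p.1, sx (p.1 (xx p.2)) p.2) := by
    rintro ⟨D, b⟩
    simp [hxx, hsx]
  exact nrm_comp_perm hinv.toPerm f

theorem nrm_compQuery [Nonempty Y] (hsx : ∀ a b, sx a (sx a b) = b)
    (hxx : ∀ a b, xx (sx a b) = xx b) (f : (I → Option Y) × β → ℂ) :
    nrm (compQuery xx sx f) = nrm f := by
  rw [compQuery, nrm_slotRefl, nrm_slotQuery hsx hxx, nrm_slotRefl]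

theorem compQuery_add (f g : (I → Option Y) × β → ℂ) :
    compQuery xx sx (f + g) = compQuery xx sx f + compQuery xx sx g := by
  have h : ∀ f g : (I → Option Y) × β → ℂ,
      slotRefl xx (f + g) = slotRefl xx f + slotRefl xx g := by
    intro f g
    funext p
    simp only [slotRefl, siteRefl, siteAmp, Pi.add_apply, mul_add, Finset.sum_add_distrib]
    ring
  rw [compQuery, h, show slotQuery xx sx (slotRefl xx f + slotRefl xx g) =
    slotQuery xx sx (slotRefl xx f) + slotQuery xx sx (slotRefl xx g) from rfl, h]
  rfl

/-- The query reads only the entry at `xx b`, so reflections elsewhere see it as a constant and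
commute with it. At `xx b` itself, the reflection squares to the identity. -/
theorem multiRefl_slotQuery [Nonempty Y] (hxx : ∀ a b, xx (sx a b) = xx b)
    (f : (I → Option Y) × β → ℂ) :
    (fun p : (I → Option Y) × β =>
      multiRefl Finset.univ (fun D => slotQuery xx sx f (D, p.2)) p.1) =
    compQuery xx sx fun p => multiRefl Finset.univ (fun D => f (D, p.2)) p.1 := by
  have hu : ∀ x : I, (Finset.univ : Finset I) = insert x (Finset.univ.erase x) :=
    fun x => (Finset.insert_erase (Finset.mem_univ x)).symm
  funext ⟨D, b⟩
  set X := (Finset.univ : Finset I).erase (xx b) with hX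
  have hx : xx b ∉ X := Finset.notMem_erase _ _
  have h1 : ∀ b', xx b' = xx b → ∀ D, slotRefl xx
      (fun p => multiRefl Finset.univ (fun D => f (D, p.2)) p.1) (D, b') =
        multiRefl X (fun D => f (D, b')) D := by
    intro b' hb' D
    simp only [slotRefl, hb']
    rw [hu (xx b), ← hX]
    simp only [multiRefl_insert hx]
    exact congrFun (siteRefl_siteRefl (xx b) (multiRefl X fun D => f (D, b'))) D
  simp only [compQuery]
  rw [slotRefl]
  simp only [slotQuery, h1 _ (hxx _ b)]
  rw [hu (xx b), ← hX, multiRefl_insert hx]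
  congr 1
  funext D'
  exact multiRefl_param X (fun D => D (xx b))
    (fun z hz D a => Function.update_of_ne (by rintro rfl; exact hx hz) _ _)
    (fun a D => f (D, sx a b)) D'

/-- On each fibre the defect has rank one. Its overlap costs a factor 2 by Cauchy–Schwarz, and `B`
sees at most `t` entries of `reflVec`, each of squared size 1/|Y|; the large entry at ⊥ is excluded.
-/
theorem nrm_indicator_slotDefect_le [Nonempty Y] (B G : Set ((I → Option Y) × β)) (t : ℕ)
    (hcard : ∀ D b, (∃ a, (Function.update D (xx b) a, b) ∈ G) →
      (Function.update D (xx b) none, b) ∉ B ∧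
        {y | (Function.update D (xx b) (some y), b) ∈ B}.ncard ≤ t)
    (f : (I → Option Y) × β → ℂ)
    (hf : ∀ D b, f (D, b) ≠ 0 → ∃ a, (Function.update D (xx b) a, b) ∈ G) :
    nrm (B.indicator (slotDefect xx f)) ≤ √(2 * t / Fintype.card Y) * nrm f := by
  classical
  refine nrm_le_mul_of_sum_le (Real.sqrt_nonneg _) ?_
  rw [Real.sq_sqrt (by positivity), Fintype.sum_prod_type_right, Fintype.sum_prod_type_right,
    Finset.mul_sum]
  refine Finset.sum_le_sum fun b _ => ?_
  rw [Finset.mul_sum]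
  refine sum_le_sum_of_fiber_le (xx b) fun D => ?_
  rw [← Finset.mul_sum]
  set s := siteAmp (xx b) (fun D => f (D, b)) D with hs
  have hF : ∀ a, ‖B.indicator (slotDefect xx f) (Function.update D (xx b) a, b)‖ ^ 2 =
      if (Function.update D (xx b) a, b) ∈ B then reflVec Y a ^ 2 * ‖s‖ ^ 2 else 0 := by
    intro a
    rw [Set.indicator_apply]
    split_ifs
    · simp [slotDefect, hs, mul_pow]
    · simp
  by_cases h0 : ∃ a, f (Function.update D (xx b) a, b) ≠ 0
  · obtain ⟨a, ha⟩ := h0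
    obtain ⟨hn, hc⟩ := hcard D b (by simpa using hf _ _ ha)
    simp only [hF]
    rw [Fintype.sum_option, if_neg hn, zero_add, ← Finset.sum_filter]
    simp only [reflVec_some, neg_sq, inv_pow, Nat.cast_nonneg, Real.sq_sqrt, Finset.sum_const,
      nsmul_eq_mul]
    have hc' : (((Finset.univ.filter fun y =>
        (Function.update D (xx b) (some y), b) ∈ B).card : ℕ) : ℝ) ≤ t := by
      rw [Set.ncard_eq_toFinset_card'] at hc
      simp only [Set.toFinset_ofPred] at hc
      exact_mod_cast hc
    calc _ ≤ (t : ℝ) * ((Fintype.card Y : ℝ)⁻¹ *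
          (2 * ∑ a, ‖f (Function.update D (xx b) a, b)‖ ^ 2)) := by
          gcongr
          exact norm_siteAmp_sq_le (xx b) (fun D => f (D, b)) D
      _ = _ := by ring
  · push Not at h0
    have : s = 0 := by simp [hs, siteAmp, h0]
    simp only [hF, this]
    simp [h0]

/-- Amplitude bound for a transition into `B`, when every fibre that meets the support `G` of the
state contains at most `t` elements of `B`. -/
theorem nrm_indicator_compQuery_le [Nonempty Y] (hsx : ∀ a b, sx a (sx a b) = b)
    (hxx : ∀ a b, xx (sx a b) = xx b) (B G : Set ((I → Option Y) × β)) (t : ℕ)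
    (hB : ∀ D a b, (D, sx a b) ∈ B ↔ (D, b) ∈ B) (hG : ∀ D a b, (D, sx a b) ∈ G ↔ (D, b) ∈ G)
    (hGB : Disjoint G B)
    (hcard : ∀ D b, (∃ a, (Function.update D (xx b) a, b) ∈ G) →
      (Function.update D (xx b) none, b) ∉ B ∧
        {y | (Function.update D (xx b) (some y), b) ∈ B}.ncard ≤ t)
    (f : (I → Option Y) × β → ℂ) (hf : ∀ p, f p ≠ 0 → p ∈ G) :
    nrm (B.indicator (compQuery xx sx f)) ≤ 2 * √(2 * t / Fintype.card Y) * nrm f := by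
  classical
  have hQ : ∀ g : (I → Option Y) × β → ℂ,
      B.indicator (slotQuery xx sx g) = slotQuery xx sx (B.indicator g) := by
    intro g
    funext ⟨D, b⟩
    simp only [slotQuery, Set.indicator_apply, hB]
  set h := slotQuery xx sx (slotRefl xx f) with hh
  -- Write both reflections as identity minus defect. The term free of defects vanishes on `B`,
  -- because `f` does and the query preserves `B`; the two defects left over give the factor 2.
  have e : B.indicator (compQuery xx sx f) =
      -slotQuery xx sx (B.indicator (slotDefect xx f)) +
        -B.indicator (slotDefect xx h) := by
    have e1 : h = slotQuery xx sx f + -slotQuery xx sx (slotDefect xx f) := by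
      rw [hh, slotRefl_eq]; rfl
    have e2 : B.indicator f = 0 := by
      funext p
      by_cases hp : p ∈ B
      · rw [Set.indicator_of_mem hp]
        by_contra hne
        exact Set.disjoint_left.1 hGB (hf p hne) hp
      · rw [Set.indicator_of_notMem hp]; rfl
    have e3 : B.indicator h = -slotQuery xx sx (B.indicator (slotDefect xx f)) := by
      rw [e1, Set.indicator_add', Set.indicator_neg', hQ, hQ, e2]
      funext p; simp [slotQuery]
    rw [compQuery, ← hh, slotRefl_eq, Set.indicator_add', Set.indicator_neg', e3]
  have hfsupp : ∀ D b, f (D, b) ≠ 0 → ∃ a, (Function.update D (xx b) a, b) ∈ G :=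
    fun D b hne => ⟨D (xx b), by simpa using hf _ hne⟩
  have hhsupp : ∀ D b, h (D, b) ≠ 0 → ∃ a, (Function.update D (xx b) a, b) ∈ G := by
    intro D b hne
    by_contra hcon
    push Not at hcon
    refine hne ?_
    have hz : ∀ a c, f (Function.update D (xx b) a, sx c b) = 0 := fun a c => by
      by_contra hne'
      exact hcon a ((hG _ _ _).1 (hf _ hne'))
    have hz' : ∀ c, f (D, sx c b) = 0 := fun c => by
      simpa using hz (D (xx b)) c
    simp [hh, slotQuery, slotRefl, siteRefl, siteAmp, hxx, hz, hz']
  have b1 := nrm_indicator_slotDefect_le B G t hcard f hfsupp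
  have b2 := nrm_indicator_slotDefect_le B G t hcard h hhsupp
  rw [hh, nrm_slotQuery hsx hxx, nrm_slotRefl, ← hh] at b2
  rw [e]
  refine (nrm_add_le _ _).trans ?_
  rw [nrm_neg, nrm_neg, nrm_slotQuery hsx hxx]
  linarith

end Slot

/-! ### Comparing prescribed values before and after compression -/

section Output

variable {I Y : Type*} [Fintype I] [DecidableEq I] [Fintype Y]

theorem multiRefl_multiRefl [Nonempty Y] (X : Finset I) (f : (I → Option Y) → ℂ) :
    multiRefl X (multiRefl X f) = f := by
  induction X using Finset.induction_on generalizing f with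
  | empty => rfl
  | insert z X hz ih => rw [multiRefl_insert hz, multiRefl_insert' hz, ih, siteRefl_siteRefl]

theorem siteRefl_eq_zero {x z : I} (h : z ≠ x) {f : (I → Option Y) → ℂ}
    (hf : ∀ D, D z = none → f D = 0) (D : I → Option Y) (hD : D z = none) :
    siteRefl x f D = 0 := by
  have : ∀ a, f (Function.update D x a) = 0 := fun a => hf _ (by rwa [Function.update_of_ne h])
  simp [siteRefl, siteAmp, this, hf D hD]

/-- Without amplitude at ⊥, the reflected amplitude there is minus the overlap with `reflVec`, which
also governs the change at `y`. -/
theorem sub_siteRefl_of_eq_some {x : I} {f : (I → Option Y) → ℂ}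
    (hf : ∀ D, D x = none → f D = 0) {D : I → Option Y} {y : Y} (hD : D x = some y) :
    f D - siteRefl x f D =
      ((√(Fintype.card Y))⁻¹ : ℝ) * siteRefl x f (Function.update D x none) := by
  rw [siteRefl_update, hf (Function.update D x none) (by simp), siteRefl, hD]
  simp

/-- Cauchy–Schwarz for (√k, 1) and (A, B); it makes the error over k coordinates grow like √k, not
k. -/
theorem sqrt_mul_add_le {c k A B : ℝ} (hk : 0 ≤ k) :
    √(k * c) * A + √c * B ≤ √((k + 1) * c) * √(A ^ 2 + B ^ 2) := by
  rw [Real.sqrt_mul hk, Real.sqrt_mul (by positivity)]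
  have h : √k * A + B ≤ √(k + 1) * √(A ^ 2 + B ^ 2) := by
    rw [← Real.sqrt_mul (by positivity)]
    refine Real.le_sqrt_of_sq_le ?_
    have := Real.sq_sqrt hk
    nlinarith [sq_nonneg (√k * B - A)]
  calc _ = (√k * A + B) * √c := by ring
    _ ≤ (√(k + 1) * √(A ^ 2 + B ^ 2)) * √c := by gcongr
    _ = _ := by ring

/-- For a state without `⊥` in the coordinates `X`, the amplitudes of prescribed values in these
coordinates change little under `multiRefl X`. -/
theorem nrm_indicator_sub_multiRefl_le [Nonempty Y] (y : I → Y) (X : Finset I)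
    (f : (I → Option Y) → ℂ) (hf : ∀ x ∈ X, ∀ D, D x = none → f D = 0) :
    nrm ({D | ∀ x ∈ X, D x = some (y x)}.indicator (f - multiRefl X f)) ≤
      √(X.card * (Fintype.card Y : ℝ)⁻¹) * nrm f := by
  classical
  induction X using Finset.induction_on generalizing f with
  | empty => simp [nrm]
  | insert x X hx ih =>
    set M : ℝ := (Fintype.card Y : ℝ) with hM
    set g := siteRefl x f with hg
    set E : Set (I → Option Y) := {D | D x = some (y x)} with hE
    set N : Set (I → Option Y) := {D | D x = none} with hN
    have hfx := hf x (Finset.mem_insert_self _ _)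
    have hgX : ∀ z ∈ X, ∀ D, D z = none → E.indicator g D = 0 := by
      intro z hz D hD
      have hne : z ≠ x := by rintro rfl; exact hx hz
      have : g D = 0 := siteRefl_eq_zero hne (hf z (Finset.mem_insert_of_mem hz)) D hD
      rw [Set.indicator_apply, this, ite_self]
    have h1 := ih (E.indicator g) hgX
    rw [multiRefl_indicator X E (fun z hz D a => by
      have hne : x ≠ z := by rintro rfl; exact hx hz
      simp [hE, Function.update_of_ne hne])] at h1
    set u : (I → Option Y) → ℂ :=
      E.indicator fun D => ((√M)⁻¹ : ℝ) * g (Function.update D x none) with hu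
    -- Telescoping through `g`: the change made by `X` acts on `g`, and on `E` the difference `f -
    -- g` is a multiple of `g` at ⊥.
    have hsplit : {D | ∀ z ∈ insert x X, D z = some (y z)}.indicator
        (f - multiRefl (insert x X) f) =
        {D | ∀ z ∈ X, D z = some (y z)}.indicator (E.indicator g - E.indicator (multiRefl X g)) +
        {D | ∀ z ∈ X, D z = some (y z)}.indicator u := by
      rw [multiRefl_insert' hx, ← hg]
      funext D
      simp only [Pi.add_apply, Pi.sub_apply, Set.indicator_apply, hu, hE, Set.mem_ofPred_eq,
        Finset.forall_mem_insert]
      by_cases hD : D x = some (y x)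
      · simp only [hD, true_and, if_true]
        split_ifs
        · rw [← sub_siteRefl_of_eq_some hfx hD]; ring
        · simp
      · simp [hD]
    have h2 : nrm u ≤ √M⁻¹ * nrm (N.indicator g) := by
      refine nrm_le_mul_of_sum_le (Real.sqrt_nonneg _) ?_
      rw [Finset.mul_sum]
      refine sum_le_sum_of_fiber_le x fun D => ?_
      rw [Fintype.sum_option, Fintype.sum_option,
        Finset.sum_eq_single_of_mem (y x) (Finset.mem_univ _)]
      · simp [hu, hE, hN, mul_pow]
      · intro b _ hb
        simp [hu, hE, hb]
    -- The two errors are controlled by orthogonal pieces of `g`, as `E` and `N` are disjoint.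
    have h3 : nrm (E.indicator g) ^ 2 + nrm (N.indicator g) ^ 2 ≤ nrm f ^ 2 := by
      rw [← nrm_siteRefl x f, ← hg, nrm_sq, nrm_sq, nrm_sq, ← Finset.sum_add_distrib]
      refine Finset.sum_le_sum fun D _ => ?_
      simp only [Set.indicator_apply, hE, hN, Set.mem_ofPred_eq]
      by_cases hD : D x = none
      · simp [hD]
      · simp only [hD, if_false]
        split_ifs <;> simp
    rw [hsplit]
    refine (nrm_add_le _ _).trans ((add_le_add h1 ((nrm_indicator_le _ _).trans h2)).trans
      ((sqrt_mul_add_le (Nat.cast_nonneg _)).trans ?_))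
    rw [Finset.card_insert_of_notMem hx]
    push_cast
    gcongr
    exact Real.sqrt_le_iff.2 ⟨nrm_nonneg _, h3⟩

/-- Only the coordinates in `X` cost anything: the other reflections preserve the norm on a cylinder
that does not constrain them. -/
theorem sum_indicator_le_multiRefl [Nonempty Y] (D₀ : I → Option Y) (X : Finset I)
    (hD₀ : ∀ x ∈ X, D₀ x ≠ none)
    (f : (I → Option Y) → ℂ) (hf : ∀ x ∈ X, ∀ D, D x = none → f D = 0) :
    nrm ({D | ∀ x ∈ X, D x = D₀ x}.indicator f) ^ 2 ≤
      2 * nrm ({D | ∀ x ∈ X, D x = D₀ x}.indicator (multiRefl Finset.univ f)) ^ 2 +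
        2 * (X.card / Fintype.card Y) * nrm f ^ 2 := by
  classical
  obtain ⟨y₀⟩ := ‹Nonempty Y›
  have : Nonempty Y := ⟨y₀⟩
  set s : Set (I → Option Y) := {D | ∀ x ∈ X, D x = D₀ x} with hs
  have hs' : s = {D | ∀ x ∈ X, D x = some ((D₀ x).getD y₀)} := by
    ext D
    refine forall₂_congr fun x hx => ?_
    obtain ⟨y, hy⟩ := Option.ne_none_iff_exists'.1 (hD₀ x hx)
    simp [hy]
  have h1 := nrm_indicator_sub_multiRefl_le (fun x => (D₀ x).getD y₀) X f hf
  rw [← hs'] at h1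
  have h2 : nrm (s.indicator (multiRefl X f)) = nrm (s.indicator (multiRefl Finset.univ f)) := by
    rw [← Finset.sdiff_union_of_subset (Finset.subset_univ X),
      multiRefl_union Finset.sdiff_disjoint, ← multiRefl_indicator (Finset.univ \ X) s, nrm_multiRefl]
    intro z hz D a
    refine forall₂_congr fun x hx => ?_
    rw [Function.update_of_ne]
    rintro rfl
    exact (Finset.mem_sdiff.1 hz).2 hx
  have h3 : s.indicator f = s.indicator (f - multiRefl X f) + s.indicator (multiRefl X f) := by
    rw [← Set.indicator_add', sub_add_cancel]
  have h4 : nrm (s.indicator f) ≤ √(X.card * (Fintype.card Y : ℝ)⁻¹) * nrm f +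
      nrm (s.indicator (multiRefl Finset.univ f)) := by
    rw [h3, ← h2]
    exact (nrm_add_le _ _).trans (by gcongr)
  have h5 : √(X.card * (Fintype.card Y : ℝ)⁻¹) ^ 2 = X.card / Fintype.card Y := by
    rw [Real.sq_sqrt (by positivity), div_eq_mul_inv]
  rw [← h5]
  have h6 := nrm_nonneg (s.indicator f)
  nlinarith [sq_nonneg (√(X.card * (Fintype.card Y : ℝ)⁻¹) * nrm f -
      nrm (s.indicator (multiRefl Finset.univ f))), nrm_nonneg f]

/-- Each reflection replaces one ⊥ by the uniform superposition, contributing one factor |Y|^(-1/2).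
-/
theorem multiRefl_init [Nonempty Y] (X : Finset I) :
    multiRefl X (fun D : I → Option Y => if ∀ x, D x = none then (1 : ℂ) else 0) =
      fun D => if ∀ x, (D x = none ↔ x ∉ X) then (((√(Fintype.card Y))⁻¹ : ℝ) : ℂ) ^ X.card
        else 0 := by
  classical
  induction X using Finset.induction_on with
  | empty => simp
  | insert x X hx ih =>
    rw [multiRefl_insert hx, ih]
    set c : ℂ := (((√(Fintype.card Y))⁻¹ : ℝ) : ℂ)
    have hupd : ∀ (D : I → Option Y) (a : Option Y),
        (∀ z, (Function.update D x a z = none ↔ z ∉ X)) ↔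
          a = none ∧ ∀ z, z ≠ x → (D z = none ↔ z ∉ X) := by
      intro D a
      constructor
      · intro h
        refine ⟨by simpa [hx] using h x, fun z hz => by simpa [hz] using h z⟩
      · rintro ⟨rfl, h⟩ z
        rcases eq_or_ne z x with rfl | hz
        · simp [hx]
        · simpa [hz] using h z hz
    funext D
    have hD1 : (∀ z, (D z = none ↔ z ∉ X)) ↔
        D x = none ∧ ∀ z, z ≠ x → (D z = none ↔ z ∉ X) := by
      simpa using hupd D (D x)
    have hD2 : (∀ z, (D z = none ↔ z ∉ insert x X)) ↔
        D x ≠ none ∧ ∀ z, z ≠ x → (D z = none ↔ z ∉ X) := by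
      constructor
      · intro h
        exact ⟨by simpa using h x, fun z hz => by simpa [hz] using h z⟩
      · rintro ⟨h1, h⟩ z
        rcases eq_or_ne z x with rfl | hz
        · simpa using h1
        · simpa [hz] using h z hz
    rw [siteRefl, siteAmp]
    simp only [hupd, hD1, hD2, Fintype.sum_option]
    by_cases h : ∀ z, z ≠ x → (D z = none ↔ z ∉ X)
    · simp only [eq_true h, and_true]
      rcases hDx : D x with _ | y
      · simp
      · simp [Finset.card_insert_of_notMem hx, c, pow_succ']
    · simp only [eq_false h, and_false, if_false]
      simp

end Output

/-! ### Walks in a database and the invariant within a batch -/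

section Walk

variable {I Y : Type*} (edge : Y → I → Prop)

/-- `p 0, …, p (n - 1)` are in the database `D`, and consecutive ones are joined by edges. -/
def IsWalk (D : I → Option Y) (n : ℕ) (p : ℕ → I) : Prop :=
  (∀ i < n, D (p i) ≠ none) ∧ ∀ i, i + 1 < n → ∃ y, D (p i) = some y ∧ edge y (p (i + 1))

/-- Hash values with an edge to a string in `X` or in the database `D`. -/
def reach (D : I → Option Y) (X : Finset I) : Set Y := {y | ∃ x, edge y x ∧ (D x ≠ none ∨ x ∈ X)}

/-- Invariant violated in the middle of a batch with query points `X'`, the points of `X` having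
been processed. -/
def BatchBad (X X' : Finset I) (r : ℕ) (D : I → Option Y) : Prop :=
  ∃ p, IsWalk edge D (r + 1) p ∧
    ((∀ i ≤ r, p i ∉ X) ∨ ∃ y, D (p r) = some y ∧ y ∈ reach edge D X')

variable {edge}

theorem batchBad_empty {X' : Finset I} {r : ℕ} {D : I → Option Y}
    (h : BatchBad edge ∅ X' r D) : ∃ p, IsWalk edge D (r + 1) p := by
  obtain ⟨p, hp, -⟩ := h
  exact ⟨p, hp⟩

/-- At the end of a batch: the last string is in the database, so the value before it lies in
`reach`. With `batchBad_empty` at the start, a batch gains one string. -/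
theorem batchBad_of_isWalk {X X' : Finset I} {r : ℕ} {D : I → Option Y} {p : ℕ → I}
    (h : IsWalk edge D (r + 2) p) : BatchBad edge X X' r D := by
  refine ⟨p, ⟨fun i hi => h.1 i (by omega), fun i hi => h.2 i (by omega)⟩, Or.inr ?_⟩
  obtain ⟨y, hy, he⟩ := h.2 r (by omega)
  exact ⟨y, hy, p (r + 1), he, Or.inl (h.1 _ (by omega))⟩

/-- Marking a point as processed only shrinks the bad set, so badness can arise only by a change of
the database. -/
theorem BatchBad.mono {X₁ X₂ X' : Finset I} (hX : X₁ ⊆ X₂) {r : ℕ} {D : I → Option Y}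
    (h : BatchBad edge X₂ X' r D) : BatchBad edge X₁ X' r D := by
  obtain ⟨p, hp, h⟩ := h
  exact ⟨p, hp, h.imp (fun h i hi hm => h i hi (hX hm)) id⟩

variable [DecidableEq I]

/-- All points of the batch count as present from the outset, so the dangerous values are fixed
along a fibre. -/
theorem reach_update {x : I} {X' : Finset I} (hx : x ∈ X') (D : I → Option Y) (a : Option Y) :
    reach edge (Function.update D x a) X' = reach edge D X' := by
  ext y
  refine exists_congr fun z => and_congr_right fun _ => ?_
  rcases eq_or_ne z x with rfl | hz
  · simp [hx]
  · simp [hz]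

/-- If the bad walk avoids `x`, it was bad before. If it meets `x`, it cannot avoid the processed
points; then the value at `x` has an edge to the next string of the walk or, at the end of the walk,
lies in `reach` by the second alternative. -/
theorem BatchBad.exists_mem_reach {x : I} {X X' : Finset I} (hx : x ∈ X') {r : ℕ}
    {D : I → Option Y} {a c : Option Y}
    (h0 : ¬ BatchBad edge X X' r (Function.update D x a))
    (h : BatchBad edge (insert x X) X' r (Function.update D x c)) :
    ∃ y ∈ reach edge D X', c = some y := by
  obtain ⟨p, hp, h⟩ := h
  by_cases hxp : ∃ i ≤ r, p i = x
  · obtain ⟨i, hi, hix⟩ := hxp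
    have h' : ∃ y, Function.update D x c (p r) = some y ∧
        y ∈ reach edge (Function.update D x c) X' := by
      rcases h with h | h
      · exact absurd (by simp [hix]) (h i hi)
      · exact h
    have hpi : Function.update D x c (p i) = c := by simp [hix]
    rcases hi.eq_or_lt with rfl | hlt
    · obtain ⟨y, hy, hm⟩ := h'
      rw [reach_update hx] at hm
      exact ⟨y, hm, hpi.symm.trans hy⟩
    · obtain ⟨y, hy, he⟩ := hp.2 i (by omega)
      refine ⟨y, ?_, hpi.symm.trans hy⟩
      rw [← reach_update hx D c]
      exact ⟨_, he, Or.inl (hp.1 _ (by omega))⟩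
  · push Not at hxp
    refine absurd ?_ h0
    have hu : ∀ i ≤ r, Function.update D x a (p i) = Function.update D x c (p i) := fun i hi => by
      rw [Function.update_of_ne (hxp i hi), Function.update_of_ne (hxp i hi)]
    refine ⟨p, ⟨fun i hi => ?_, fun i hi => ?_⟩, ?_⟩
    · rw [hu i (by omega)]; exact hp.1 i hi
    · rw [hu i (by omega)]; exact hp.2 i hi
    · rw [hu r le_rfl, reach_update hx]
      rw [reach_update hx] at h
      exact h.imp (fun h i hi hm => h i hi (Finset.mem_insert_of_mem hm)) id

variable [Fintype I]

open Classical in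
/-- The strings in the database `D` or in `X`. -/
noncomputable def dbSupport (D : I → Option Y) (X : Finset I) : Finset I :=
  Finset.univ.filter fun x => D x ≠ none ∨ x ∈ X

theorem dbSupport_update {x : I} {X : Finset I} (hx : x ∈ X) (D : I → Option Y) (a : Option Y) :
    dbSupport (Function.update D x a) X = dbSupport D X := by
  ext z
  rcases eq_or_ne z x with rfl | hz
  · simp [dbSupport, hx]
  · simp [dbSupport, hz]

theorem dbSupport_empty_subset (D : I → Option Y) (X : Finset I) :
    dbSupport D ∅ ⊆ dbSupport D X := by
  intro z
  simp only [dbSupport, Finset.mem_filter_univ, Finset.notMem_empty, or_false]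
  exact Or.inl

theorem card_dbSupport_le (D : I → Option Y) (X : Finset I) :
    (dbSupport D X).card ≤ (dbSupport D ∅).card + X.card := by
  refine (Finset.card_le_card fun z => ?_).trans (Finset.card_union_le _ _)
  simp [dbSupport]

theorem ncard_reach_le [Fintype Y] {m : ℕ} (hm : ∀ x, {y | edge y x}.ncard ≤ m)
    (D : I → Option Y) (X : Finset I) :
    (reach edge D X).ncard ≤ (dbSupport D X).card * m := by
  classical
  have e : reach edge D X = ((dbSupport D X).biUnion fun x => {y | edge y x}.toFinset : Finset Y) := by
    ext y
    simp [reach, dbSupport, and_comm]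
  rw [e, Set.ncard_coe_finset]
  refine Finset.card_biUnion_le_card_mul _ _ _ fun x _ => ?_
  rw [← Set.ncard_eq_toFinset_card']
  exact hm x

end Walk

/-! ### Processing a batch slot by slot -/

section Batch

variable {I Y β : Type*} [Fintype I] [DecidableEq I] [Fintype Y] [Fintype β] {q : ℕ}

/-- The operators `Q j`, `j < k`, applied one after another. -/
def iterOps {V : Type*} (Q : Fin q → V → V) : ℕ → V → V
  | 0, f => f
  | k + 1, f => if h : k < q then Q ⟨k, h⟩ (iterOps Q k f) else iterOps Q k f

theorem iterOps_succ {V : Type*} (Q : Fin q → V → V) (j : Fin q) (f : V) :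
    iterOps Q (j + 1) f = Q j (iterOps Q j f) := by simp [iterOps]

/-- The points queried in the first `k` slots. -/
def slotPts (xs : Fin q → β → I) (k : ℕ) (b : β) : Finset I :=
  (Finset.univ.filter fun j : Fin q => (j : ℕ) < k).image fun j => xs j b

theorem slotPts_succ (xs : Fin q → β → I) (j : Fin q) (b : β) :
    slotPts xs (j + 1) b = insert (xs j b) (slotPts xs j b) := by
  have : (Finset.univ.filter fun i : Fin q => (i : ℕ) < j + 1) =
      insert j (Finset.univ.filter fun i : Fin q => (i : ℕ) < j) := by
    ext i
    simp [le_iff_eq_or_lt, Fin.ext_iff]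
  rw [slotPts, slotPts, this, Finset.image_insert]

theorem card_slotPts_le (xs : Fin q → β → I) (k : ℕ) (b : β) : (slotPts xs k b).card ≤ k := by
  refine Finset.card_image_le.trans ?_
  rw [Fin.card_filter_val_lt]
  exact min_le_right _ _

/-- `multiRefl` in all database coordinates. -/
noncomputable def fullRefl (f : (I → Option Y) × β → ℂ) (p : (I → Option Y) × β) : ℂ :=
  multiRefl Finset.univ (fun D => f (D, p.2)) p.1

variable {xs : Fin q → β → I} {sx : Fin q → Option Y → β → β}

theorem fullRefl_iterOps [Nonempty Y] (hxs : ∀ i j a b, xs i (sx j a b) = xs i b) (k : ℕ)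
    (f : (I → Option Y) × β → ℂ) :
    fullRefl (iterOps (fun j => slotQuery (xs j) (sx j)) k f) =
      iterOps (fun j => compQuery (xs j) (sx j)) k (fullRefl f) := by
  induction k with
  | zero => rfl
  | succ k ih =>
    simp only [iterOps]
    split_ifs
    · rw [← ih]
      exact multiRefl_slotQuery (fun a b => hxs _ _ a b) _
    · exact ih

theorem nrm_iterOps_compQuery [Nonempty Y] (hsx : ∀ j a b, sx j a (sx j a b) = b)
    (hxs : ∀ i j a b, xs i (sx j a b) = xs i b) (k : ℕ) (f : (I → Option Y) × β → ℂ) :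
    nrm (iterOps (fun j => compQuery (xs j) (sx j)) k f) = nrm f := by
  induction k with
  | zero => rfl
  | succ k ih =>
    simp only [iterOps]
    split_ifs
    · rw [nrm_compQuery (hsx _) (hxs _ _), ih]
    · exact ih

/-- Used for the size of the database together with all batch points, which no query of the batch
changes. -/
theorem compQuery_support {xx : β → I} {sy : Option Y → β → β} (hxx : ∀ a b, xx (sy a b) = xx b)
    (P : Set ((I → Option Y) × β)) (hP : ∀ D a b, (D, sy a b) ∈ P ↔ (D, b) ∈ P)
    (hPu : ∀ D a b, (Function.update D (xx b) a, b) ∈ P ↔ (D, b) ∈ P)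
    {f : (I → Option Y) × β → ℂ} (hf : ∀ p, f p ≠ 0 → p ∈ P) :
    ∀ p, compQuery xx sy f p ≠ 0 → p ∈ P := by
  rintro ⟨D, b⟩ hne
  by_contra hcon
  have h0 : ∀ D', (D', b) ∉ P → ∀ a, f (D', sy a b) = 0 := fun D' hD' a => by
    by_contra h
    exact hD' ((hP _ _ _).1 (hf _ h))
  have h2 : ∀ D', (D', b) ∉ P → ∀ a c, f (Function.update D' (xx b) a, sy c b) = 0 :=
    fun D' hD' a c => h0 _ (fun h => hD' ((hPu _ _ _).1 h)) _
  refine hne ?_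
  simp [compQuery, slotRefl, siteRefl, siteAmp, slotQuery, hxx, h0 D hcon, h2 D hcon]

variable {edge : Y → I → Prop}

theorem iterOps_compQuery_bound [Nonempty Y] (hsx : ∀ j a b, sx j a (sx j a b) = b)
    (hxs : ∀ i j a b, xs i (sx j a b) = xs i b) {m : ℕ} (hm : ∀ x, {y | edge y x}.ncard ≤ m)
    {n k r : ℕ} (hk : k ≤ q) (f : (I → Option Y) × β → ℂ)
    (hf : ∀ p, f p ≠ 0 → (dbSupport p.1 (slotPts xs k p.2)).card ≤ n) {j : ℕ} (hj : j ≤ k) :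
    (∀ p, iterOps (fun j => compQuery (xs j) (sx j)) j f p ≠ 0 →
      (dbSupport p.1 (slotPts xs k p.2)).card ≤ n) ∧
    nrm ({p | BatchBad edge (slotPts xs j p.2) (slotPts xs k p.2) r p.1}.indicator
        (iterOps (fun j => compQuery (xs j) (sx j)) j f)) ≤
      nrm ({p | ∃ w, IsWalk edge p.1 (r + 1) w}.indicator f) +
        j * (2 * √(2 * (n * m : ℕ) / Fintype.card Y)) * nrm f := by
  classical
  have hpts : ∀ i l a b, slotPts xs i (sx l a b) = slotPts xs i b := fun i l a b => by
    simp only [slotPts, hxs]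
  induction j with
  | zero =>
    refine ⟨hf, ?_⟩
    simp only [Nat.cast_zero, zero_mul, add_zero, iterOps]
    refine nrm_le_of_norm_le fun p => ?_
    refine norm_indicator_le_of_subset (fun p hp => ?_) _ _
    refine batchBad_empty (X' := slotPts xs k p.2) ?_
    simpa [slotPts] using hp
  | succ j ih =>
    obtain ⟨ih1, ih2⟩ := ih (by omega)
    obtain ⟨i, rfl⟩ : ∃ i : Fin q, (i : ℕ) = j := ⟨⟨j, by omega⟩, rfl⟩
    set g := iterOps (fun j => compQuery (xs j) (sx j)) i f with hg
    have hgn : nrm g = nrm f := nrm_iterOps_compQuery hsx hxs _ _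
    have hmem : ∀ b, xs i b ∈ slotPts xs k b := fun b =>
      Finset.mem_image_of_mem (fun j => xs j b) (by simp; omega)
    rw [iterOps_succ, ← hg]
    refine ⟨compQuery_support (hxs _ _) {p | (dbSupport p.1 (slotPts xs k p.2)).card ≤ n}
      (fun D a b => by simp [hpts]) (fun D a b => by simp [dbSupport_update (hmem b)]) ih1, ?_⟩
    set B : Set ((I → Option Y) × β) :=
      {p | BatchBad edge (slotPts xs i p.2) (slotPts xs k p.2) r p.1} with hB
    set B' : Set ((I → Option Y) × β) :=
      {p | BatchBad edge (slotPts xs (i + 1) p.2) (slotPts xs k p.2) r p.1} with hB'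
    -- The part that is already bad is kept by unitarity; the good part becomes bad only through the
    -- transition bound.
    have hsplit : g = B.indicator g + Bᶜ.indicator g := (Set.indicator_self_add_compl B g).symm
    have h1 : nrm (B'.indicator (compQuery (xs i) (sx i) (B.indicator g))) ≤
        nrm (B.indicator g) :=
      (nrm_indicator_le _ _).trans (nrm_compQuery (hsx i) (hxs i i) _).le
    have h2 : nrm (B'.indicator (compQuery (xs i) (sx i) (Bᶜ.indicator g))) ≤
        2 * √(2 * (n * m : ℕ) / Fintype.card Y) * nrm (Bᶜ.indicator g) := by
      refine nrm_indicator_compQuery_le (hsx i) (hxs i i) B'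
        {p | p ∉ B ∧ (dbSupport p.1 (slotPts xs k p.2)).card ≤ n} (n * m)
        (fun D a b => by simp [hB', hpts]) (fun D a b => by simp [hB, hpts]) ?_ ?_ _ ?_
      · rw [Set.disjoint_left]
        rintro p ⟨hp, -⟩ hp'
        refine hp (BatchBad.mono ?_ hp')
        rw [slotPts_succ]
        exact Finset.subset_insert _ _
      · rintro D b ⟨a, ha, hcard⟩
        have key : ∀ c, (Function.update D (xs i b) c, b) ∈ B' →
            ∃ y ∈ reach edge D (slotPts xs k b), c = some y := by
          intro c hc
          simp only [hB', Set.mem_ofPred_eq, slotPts_succ] at hc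
          exact BatchBad.exists_mem_reach (hmem b) ha hc
        refine ⟨fun hn => ?_, ?_⟩
        · obtain ⟨y, -, hy⟩ := key _ hn
          cases hy
        · have hsub : {y | (Function.update D (xs i b) (some y), b) ∈ B'} ⊆
              reach edge D (slotPts xs k b) := by
            intro y hy
            obtain ⟨y', hy', e⟩ := key _ hy
            cases e
            exact hy'
          refine (Set.ncard_le_ncard hsub (Set.toFinite _)).trans
            ((ncard_reach_le hm D _).trans ?_)
          rw [dbSupport_update (hmem b)] at hcard
          gcongr
      · intro p hp
        have hpB : p ∈ Bᶜ := Set.mem_of_indicator_ne_zero hp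
        refine ⟨hpB, ih1 p ?_⟩
        rwa [Set.indicator_of_mem hpB] at hp
    have h3 : nrm (Bᶜ.indicator g) ≤ nrm f := hgn ▸ nrm_indicator_le _ _
    rw [hsplit, compQuery_add, Set.indicator_add']
    refine (nrm_add_le _ _).trans ((add_le_add (h1.trans ih2) (h2.trans
      (mul_le_mul_of_nonneg_left h3 (by positivity)))).trans (le_of_eq ?_))
    push_cast
    ring

theorem iterOps_compQuery_walk_bound [Nonempty Y] (hsx : ∀ j a b, sx j a (sx j a b) = b)
    (hxs : ∀ i j a b, xs i (sx j a b) = xs i b) {m : ℕ} (hm : ∀ x, {y | edge y x}.ncard ≤ m)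
    {s k r : ℕ} (hk : s + k ≤ q) (f : (I → Option Y) × β → ℂ)
    (hf : ∀ p, f p ≠ 0 → (dbSupport p.1 ∅).card ≤ s) :
    (∀ p, iterOps (fun j => compQuery (xs j) (sx j)) k f p ≠ 0 →
      (dbSupport p.1 ∅).card ≤ s + k) ∧
    nrm ({p | ∃ w, IsWalk edge p.1 (r + 2) w}.indicator
        (iterOps (fun j => compQuery (xs j) (sx j)) k f)) ≤
      nrm ({p | ∃ w, IsWalk edge p.1 (r + 1) w}.indicator f) +
        k * (2 * √(2 * (q * m : ℕ) / Fintype.card Y)) * nrm f := by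
  obtain ⟨h1, h2⟩ := iterOps_compQuery_bound (r := r) hsx hxs hm (n := s + k) (k := k) (by omega) f
    (fun p hp => (card_dbSupport_le _ _).trans (add_le_add (hf p hp) (card_slotPts_le _ _ _)))
    le_rfl
  refine ⟨fun p hp => (Finset.card_le_card (dbSupport_empty_subset _ _)).trans (h1 p hp), ?_⟩
  refine (nrm_le_of_norm_le fun p => norm_indicator_le_of_subset ?_ _ _).trans (h2.trans ?_)
  · rintro p ⟨w, hw⟩
    exact batchBad_of_isWalk hw
  · have := nrm_nonneg f
    gcongr

end Batch

/-! ### Rounds with unitaries in between -/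

section Evolution

variable {I Y β : Type*} [Fintype I] [DecidableEq I] [Fintype Y] [Fintype β]

/-- A unitary acting on the adversary's registers only. -/
noncomputable def liftU (U : EuclideanSpace ℂ β ≃ₗᵢ[ℂ] EuclideanSpace ℂ β)
    (f : (I → Option Y) × β → ℂ) (p : (I → Option Y) × β) : ℂ :=
  U (WithLp.toLp 2 fun b => f (p.1, b)) p.2

variable (U : EuclideanSpace ℂ β ≃ₗᵢ[ℂ] EuclideanSpace ℂ β)

theorem nrm_indicator_liftU (s : Set (I → Option Y)) (f : (I → Option Y) × β → ℂ) :
    nrm ({p | p.1 ∈ s}.indicator (liftU U f)) = nrm ({p | p.1 ∈ s}.indicator f) := by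
  classical
  refine nrm_eq_of_sum_eq ?_
  rw [Fintype.sum_prod_type, Fintype.sum_prod_type]
  refine Finset.sum_congr rfl fun D _ => ?_
  by_cases h : D ∈ s
  · simp only [Set.indicator_apply, Set.mem_ofPred_eq, h, if_true, liftU]
    rw [← EuclideanSpace.norm_sq_eq, LinearIsometryEquiv.norm_map, EuclideanSpace.norm_sq_eq]
  · simp [h]

theorem nrm_liftU (f : (I → Option Y) × β → ℂ) : nrm (liftU U f) = nrm f := by
  simpa using nrm_indicator_liftU U Set.univ f

theorem liftU_support {P : (I → Option Y) → Prop} {f : (I → Option Y) × β → ℂ}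
    (hf : ∀ p, f p ≠ 0 → P p.1) : ∀ p, liftU U f p ≠ 0 → P p.1 := by
  intro p hp
  by_contra hcon
  have : (fun b => f (p.1, b)) = 0 := by
    funext b
    by_contra hne
    exact hcon (hf (p.1, b) hne)
  exact hp (by simp [liftU, this])

/-- The reflections act on the database index and `L` on the label index. -/
theorem multiRefl_linearMap (L : (β → ℂ) →ₗ[ℂ] ℂ) (X : Finset I) (f : (I → Option Y) → β → ℂ) :
    multiRefl X (fun D => L (f D)) = fun D => L fun b => multiRefl X (fun D => f D b) D := by
  induction X using Finset.induction_on with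
  | empty => rfl
  | insert x X hx ih =>
    rw [multiRefl_insert hx, ih]
    simp only [multiRefl_insert hx]
    funext D
    have e : (fun b => siteRefl x (multiRefl X fun D => f D b) D) =
        (fun b => multiRefl X (fun D => f D b) D) - (reflVec Y (D x) : ℂ) •
          ∑ a, (reflVec Y a : ℂ) • fun b => multiRefl X (fun D => f D b)
            (Function.update D x a) := by
      funext b
      simp [siteRefl, siteAmp, Finset.sum_apply]
      ring
    rw [e, map_sub, map_smul, map_sum]
    simp [siteRefl, siteAmp]

theorem fullRefl_liftU (f : (I → Option Y) × β → ℂ) :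
    fullRefl (liftU U f) = liftU U (fullRefl f) := by
  funext ⟨D, b⟩
  let L : (β → ℂ) →ₗ[ℂ] ℂ := (EuclideanSpace.proj (𝕜 := ℂ) b).toLinearMap ∘ₗ
    U.toLinearEquiv.toLinearMap ∘ₗ (WithLp.linearEquiv 2 ℂ (β → ℂ)).symm.toLinearMap
  exact congrFun (multiRefl_linearMap L Finset.univ fun D b => f (D, b)) D

variable {q : ℕ} {xs : Fin q → β → I} {sx : Fin q → Option Y → β → β} {edge : Y → I → Prop}

/-- Rounds of batches of queries `Q j`, each followed by a unitary. -/
noncomputable def evolve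
    (Q : Fin q → ((I → Option Y) × β → ℂ) → (I → Option Y) × β → ℂ) {n : ℕ} (w : Fin n → ℕ)
    (U : Fin n → (EuclideanSpace ℂ β ≃ₗᵢ[ℂ] EuclideanSpace ℂ β))
    (f : (I → Option Y) × β → ℂ) : (I → Option Y) × β → ℂ :=
  Fin.foldl n (fun f i => liftU (U i) (iterOps Q (w i) f)) f

theorem evolve_succ (Q : Fin q → ((I → Option Y) × β → ℂ) → (I → Option Y) × β → ℂ) {n : ℕ}
    (w : Fin (n + 1) → ℕ) (U : Fin (n + 1) → (EuclideanSpace ℂ β ≃ₗᵢ[ℂ] EuclideanSpace ℂ β))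
    (f : (I → Option Y) × β → ℂ) :
    evolve Q w U f = liftU (U (Fin.last n)) (iterOps Q (w (Fin.last n))
      (evolve Q (fun i => w i.castSucc) (fun i => U i.castSucc) f)) := by
  rw [evolve, Fin.foldl_succ_last, evolve]

theorem fullRefl_evolve [Nonempty Y] (hxs : ∀ i j a b, xs i (sx j a b) = xs i b) {n : ℕ}
    (w : Fin n → ℕ) (U : Fin n → (EuclideanSpace ℂ β ≃ₗᵢ[ℂ] EuclideanSpace ℂ β))
    (f : (I → Option Y) × β → ℂ) :
    fullRefl (evolve (fun j => slotQuery (xs j) (sx j)) w U f) =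
      evolve (fun j => compQuery (xs j) (sx j)) w U (fullRefl f) := by
  induction n with
  | zero => simp [evolve]
  | succ n ih => rw [evolve_succ, evolve_succ, fullRefl_liftU, fullRefl_iterOps hxs, ih]

/-- After `n` rounds the database is unlikely to contain a walk through `n + 1` strings. -/
theorem evolve_compQuery_walk_bound [Nonempty Y] (hsx : ∀ j a b, sx j a (sx j a b) = b)
    (hxs : ∀ i j a b, xs i (sx j a b) = xs i b) {m : ℕ} (hm : ∀ x, {y | edge y x}.ncard ≤ m)
    (f : (I → Option Y) × β → ℂ) (hf : ∀ p, f p ≠ 0 → ∀ x, p.1 x = none)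
    (n : ℕ) (w : Fin n → ℕ) (hw : ∑ i, w i ≤ q)
    (U : Fin n → (EuclideanSpace ℂ β ≃ₗᵢ[ℂ] EuclideanSpace ℂ β)) :
    nrm (evolve (fun j => compQuery (xs j) (sx j)) w U f) = nrm f ∧
    (∀ p, evolve (fun j => compQuery (xs j) (sx j)) w U f p ≠ 0 →
      (dbSupport p.1 ∅).card ≤ ∑ i, w i) ∧
    nrm ({p | ∃ v, IsWalk edge p.1 (n + 1) v}.indicator
        (evolve (fun j => compQuery (xs j) (sx j)) w U f)) ≤
      (∑ i, w i : ℕ) * (2 * √(2 * (q * m : ℕ) / Fintype.card Y)) * nrm f := by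
  classical
  induction n with
  | zero =>
    refine ⟨by simp [evolve], fun p hp => ?_, ?_⟩
    · have h0 := hf p (by simpa [evolve] using hp)
      simp [dbSupport, h0]
    · have : {p : (I → Option Y) × β | ∃ v, IsWalk edge p.1 (0 + 1) v}.indicator
          (evolve (fun j => compQuery (xs j) (sx j)) w U f) = 0 := by
        funext p
        refine Set.indicator_apply_eq_zero.2 ?_
        rintro ⟨v, hv⟩
        by_contra hp
        exact hv.1 0 (by omega) (hf p (by simpa [evolve] using hp) _)
      rw [this]
      simp [nrm]
  | succ n ih =>
    rw [Fin.sum_univ_castSucc] at hw ⊢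
    obtain ⟨ih1, ih2, ih3⟩ := ih (fun i => w i.castSucc) (by omega) (fun i => U i.castSucc)
    obtain ⟨h1, h2⟩ := iterOps_compQuery_walk_bound (r := n) hsx hxs hm hw _ ih2
    rw [evolve_succ]
    refine ⟨by rw [nrm_liftU, nrm_iterOps_compQuery hsx hxs, ih1],
      liftU_support (U (Fin.last n)) (P := fun D => (dbSupport D ∅).card ≤ _) h1, ?_⟩
    have e := nrm_indicator_liftU (U (Fin.last n)) {D | ∃ v, IsWalk edge D (n + 1 + 1) v}
      (iterOps (fun j => compQuery (xs j) (sx j)) (w (Fin.last n))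
        (evolve (fun j => compQuery (xs j) (sx j)) (fun i => w i.castSucc)
          (fun i => U i.castSucc) f))
    refine e.le.trans (h2.trans ((add_le_add_left ih3 _).trans (le_of_eq ?_)))
    rw [ih1]
    push_cast
    ring

end Evolution

/-! ### The adversary's queries as operations on the database register -/

section Concrete

variable {lam q : ℕ} {S S' : Finset (List Bool)} {Z : Type*} [Fintype Z]

/-- Extension by zero of a hash function on the finite set `S'`. -/
def extHash (h : S' → Bits lam) : HashFun lam :=
  fun s => if hs : s ∈ S' then h ⟨s, hs⟩ else fun _ => false

theorem extHash_apply (h : S' → Bits lam) (x : S') : extHash h x = h x := by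
  simp [extHash]

/-- The query point in slot `j`. -/
def slotPoint (hS : S ⊆ S') (j : Fin q) (b : Basis lam q S Z) : S' :=
  ⟨(b.1 j).1, hS (b.1 j).1.2⟩

/-- Add a database entry to the response register of slot `j`. -/
def slotXor (j : Fin q) (a : Option (Bits lam)) (b : Basis lam q S Z) : Basis lam q S Z :=
  match a with
  | none => b
  | some h => (Function.update b.1 j ((b.1 j).1, bxor (b.1 j).2 h), b.2)

theorem slotXor_slotXor (j : Fin q) (a : Option (Bits lam)) (b : Basis lam q S Z) :
    slotXor j a (slotXor j a b) = b := by
  rcases a with _ | h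
  · rfl
  · have e : bxor (bxor (b.1 j).2 h) h = (b.1 j).2 := by funext i; simp [bxor]
    simp [slotXor, e]

theorem slotPoint_slotXor (hS : S ⊆ S') (i j : Fin q) (a : Option (Bits lam))
    (b : Basis lam q S Z) : slotPoint hS i (slotXor j a b) = slotPoint hS i b := by
  rcases a with _ | h
  · rfl
  · rcases eq_or_ne i j with rfl | hij
    · simp [slotPoint, slotXor]
    · simp [slotPoint, slotXor, hij]

/-- A parallel batch is a succession of queries to single slots, since different slots have separate
response registers. -/
theorem queryBasis_slotXor (hS : S ⊆ S') (h : S' → Bits lam) (j : Fin q) (b : Basis lam q S Z) :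
    queryBasis (extHash h) j (slotXor j (some (h (slotPoint hS j b))) b) =
      queryBasis (extHash h) (j + 1) b := by
  refine Prod.ext (funext fun i => ?_) rfl
  have e : extHash h (b.1 j).1 = h (slotPoint hS j b) := extHash_apply h (slotPoint hS j b)
  rcases eq_or_ne i j with rfl | hij
  · simp [queryBasis, slotXor, e]
  · have : ((i : ℕ) < j + 1) ↔ (i : ℕ) < j := by
      have := Fin.val_ne_of_ne hij
      omega
    simp only [queryBasis, slotXor, Function.update_of_ne hij, this]

theorem iterOps_slotQuery_apply (hS : S ⊆ S') (h : S' → Bits lam) {k : ℕ} (hk : k ≤ q)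
    (f : (S' → Option (Bits lam)) × Basis lam q S Z → ℂ) (b : Basis lam q S Z) :
    iterOps (fun j => slotQuery (slotPoint hS j) (slotXor j)) k f (fun x => some (h x), b) =
      f (fun x => some (h x), queryBasis (extHash h) k b) := by
  induction k generalizing b with
  | zero => simp [iterOps, queryBasis]
  | succ k ih =>
    obtain ⟨j, rfl⟩ : ∃ j : Fin q, (j : ℕ) = k := ⟨⟨k, hk⟩, rfl⟩
    rw [iterOps_succ, slotQuery, ih (by omega), queryBasis_slotXor]

theorem iterOps_slotQuery_eq_zero (hS : S ⊆ S') (D : S' → Option (Bits lam)) (k : ℕ)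
    (f : (S' → Option (Bits lam)) × Basis lam q S Z → ℂ) (hf : ∀ b, f (D, b) = 0)
    (b : Basis lam q S Z) :
    iterOps (fun j => slotQuery (slotPoint hS j) (slotXor j)) k f (D, b) = 0 := by
  induction k generalizing b with
  | zero => exact hf b
  | succ k ih =>
    simp only [iterOps]
    split_ifs
    · exact ih _
    · exact ih b

theorem evolve_slotQuery_apply (hS : S ⊆ S') (h : S' → Bits lam) {n : ℕ} (w : Fin n → ℕ)
    (hw : ∀ i, w i ≤ q) (U : Fin n → (StateSpace lam q S Z ≃ₗᵢ[ℂ] StateSpace lam q S Z))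
    (f : (S' → Option (Bits lam)) × Basis lam q S Z → ℂ) (c : ℂ) (ψ : StateSpace lam q S Z)
    (hf : ∀ b, f (fun x => some (h x), b) = c * ψ b) (b : Basis lam q S Z) :
    evolve (fun j => slotQuery (slotPoint hS j) (slotXor j)) w U f (fun x => some (h x), b) =
      c * Fin.foldl n (fun ψ i => U i (parallelQuery (extHash h) (w i) ψ)) ψ b := by
  induction n generalizing b with
  | zero => simpa [evolve] using hf b
  | succ n ih =>
    have ih' := ih (fun i => w i.castSucc) (fun i => hw _) (fun i => U i.castSucc)
    rw [evolve_succ, Fin.foldl_succ_last, liftU]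
    have e : (WithLp.toLp 2 fun b => iterOps (fun j => slotQuery (slotPoint hS j) (slotXor j))
        (w (Fin.last n)) (evolve (fun j => slotQuery (slotPoint hS j) (slotXor j))
          (fun i => w i.castSucc) (fun i => U i.castSucc) f) (fun x => some (h x), b)) =
        c • parallelQuery (extHash h) (w (Fin.last n)) (Fin.foldl n (fun ψ i => U i.castSucc
          (parallelQuery (extHash h) (w i.castSucc) ψ)) ψ) := by
      ext b
      simp [iterOps_slotQuery_apply hS h (hw _), ih', parallelQuery_apply]
    simp only [e, map_smul]
    simp

theorem evolve_slotQuery_eq_zero (hS : S ⊆ S') (D : S' → Option (Bits lam)) {n : ℕ}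
    (w : Fin n → ℕ) (U : Fin n → (StateSpace lam q S Z ≃ₗᵢ[ℂ] StateSpace lam q S Z))
    (f : (S' → Option (Bits lam)) × Basis lam q S Z → ℂ)
    (hf : ∀ b, f (D, b) = 0) (b : Basis lam q S Z) :
    evolve (fun j => slotQuery (slotPoint hS j) (slotXor j)) w U f (D, b) = 0 := by
  induction n generalizing b with
  | zero => simpa [evolve] using hf b
  | succ n ih =>
    rw [evolve_succ, liftU]
    have e : (fun b => iterOps (fun j => slotQuery (slotPoint hS j) (slotXor j))
        (w (Fin.last n)) (evolve (fun j => slotQuery (slotPoint hS j) (slotXor j))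
          (fun i => w i.castSucc) (fun i => U i.castSucc) f) (D, b)) = 0 := by
      funext b
      exact iterOps_slotQuery_eq_zero hS D _ _ (ih _ _) b
    simp only [e]
    simp

end Concrete

/-! ### The initial state and its compression -/

section InitialState

variable {I Y β : Type*} [Fintype I] [DecidableEq I] [Fintype Y] [Fintype β]

/-- The empty database together with a state of the adversary. -/
noncomputable def emptyDB (φ : β → ℂ) (p : (I → Option Y) × β) : ℂ :=
  open Classical in if ∀ x, p.1 x = none then φ p.2 else 0

theorem nrm_emptyDB (φ : β → ℂ) : nrm (emptyDB (I := I) (Y := Y) φ) = nrm φ := by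
  classical
  refine nrm_eq_of_sum_eq ?_
  rw [Fintype.sum_prod_type, Finset.sum_eq_single_of_mem (fun _ => none) (Finset.mem_univ _)]
  · simp [emptyDB]
  · intro D _ hD
    refine Finset.sum_eq_zero fun b _ => ?_
    have : ¬ ∀ x, D x = none := fun h => hD (funext h)
    simp only [emptyDB, this, if_false]
    simp

theorem fullRefl_emptyDB [Nonempty Y] (φ : β → ℂ) (D : I → Option Y) (b : β) :
    fullRefl (emptyDB φ) (D, b) = if ∀ x, D x ≠ none then
      (((√(Fintype.card Y))⁻¹ : ℝ) : ℂ) ^ Fintype.card I * φ b else 0 := by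
  classical
  have h1 := congrFun (multiRefl_linearMap (φ b • LinearMap.proj ()) Finset.univ
    fun (D : I → Option Y) (_ : Unit) => if ∀ x, D x = none then (1 : ℂ) else 0) D
  simp only [LinearMap.smul_apply, LinearMap.proj_apply, smul_eq_mul, mul_ite, mul_one, mul_zero,
    multiRefl_init] at h1
  rw [fullRefl]
  simp only [emptyDB]
  convert h1 using 1
  simp [mul_comm]

theorem nrm_fullRefl [Nonempty Y] (f : (I → Option Y) × β → ℂ) : nrm (fullRefl f) = nrm f := by
  refine nrm_eq_of_sum_eq ?_
  rw [Fintype.sum_prod_type_right, Fintype.sum_prod_type_right]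
  refine Finset.sum_congr rfl fun b _ => ?_
  have := congrArg (· ^ 2) (nrm_multiRefl Finset.univ fun D => f (D, b))
  simpa only [nrm_sq, fullRefl] using this

theorem fullRefl_fullRefl [Nonempty Y] (f : (I → Option Y) × β → ℂ) :
    fullRefl (fullRefl f) = f := by
  funext ⟨D, b⟩
  exact congrFun (multiRefl_multiRefl Finset.univ fun D => f (D, b)) D

end InitialState

/-! ### The random oracle on finitely many strings -/

section Integral

variable {lam : ℕ}

theorem integral_randomOracle (S' : Finset (List Bool)) (F : HashFun lam → ℝ)
    (hF : ∀ H, F H = F (extHash (S'.restrict H))) :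
    ∫ H, F H ∂(randomOracle lam) =
      ∑ h : S' → Bits lam, ((Fintype.card (Bits lam) : ℝ)⁻¹) ^ S'.card * F (extHash h) := by
  have h1 : ∫ H, F H ∂(randomOracle lam) =
      ∫ H, (fun h : S' → Bits lam => F (extHash h)) (S'.restrict H) ∂(randomOracle lam) :=
    integral_congr_ae (Filter.Eventually.of_forall hF)
  have h2 := integral_restrict_infinitePi
    (μ := fun _ : List Bool => (PMF.uniformOfFintype (Bits lam)).toMeasure) (s := S')
    (Measurable.of_discrete (f := fun h : S' → Bits lam => F (extHash h))).aestronglyMeasurable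
  rw [h1]
  refine h2.trans ?_
  rw [integral_fintype Integrable.of_finite]
  refine Finset.sum_congr rfl fun h _ => ?_
  rw [Measure.real, Measure.pi_singleton]
  simp

end Integral

/-! ### Success probability in terms of the purified state -/

section Success

variable {lam q rounds : ℕ} {S S' : Finset (List Bool)} {Z : Type*} [Fintype Z] {Out : Type*}

/-- Joint state of the oracle register, in uniform superposition over all functions on `S'`, and of
the adversary's registers, after all rounds. -/
noncomputable def purifiedState (A : Adversary lam q rounds S Z Out) (hS : S ⊆ S') :
    (S' → Option (Bits lam)) × Basis lam q S Z → ℂ :=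
  evolve (fun j => slotQuery (slotPoint hS j) (slotXor j)) A.width A.U
    (fullRefl (emptyDB fun b => A.init b))

theorem Adversary.width_le (A : Adversary lam q rounds S Z Out) (i : Fin rounds) :
    A.width i ≤ q :=
  (Finset.single_le_sum (fun _ _ => Nat.zero_le _) (Finset.mem_univ i)).trans A.total_width_le

theorem purifiedState_apply (A : Adversary lam q rounds S Z Out) (hS : S ⊆ S')
    (h : S' → Bits lam) (b : Basis lam q S Z) :
    purifiedState A hS (fun x => some (h x), b) =
      (((√(Fintype.card (Bits lam)))⁻¹ : ℝ) : ℂ) ^ S'.card * A.finalState (extHash h) b :=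
  evolve_slotQuery_apply hS h A.width A.width_le A.U _ _ A.init
    (fun b => by simp [fullRefl_emptyDB]) b

theorem purifiedState_eq_zero (A : Adversary lam q rounds S Z Out) (hS : S ⊆ S')
    {D : S' → Option (Bits lam)} {x : S'} (hx : D x = none) (b : Basis lam q S Z) :
    purifiedState A hS (D, b) = 0 :=
  evolve_slotQuery_eq_zero hS D _ _ _ (fun b => by
    rw [fullRefl_emptyDB, if_neg fun h => h x hx]) b

theorem fullRefl_purifiedState (A : Adversary lam q rounds S Z Out) (hS : S ⊆ S') :
    fullRefl (purifiedState A hS) = evolve (fun j => compQuery (slotPoint hS j) (slotXor j))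
      A.width A.U (emptyDB fun b => A.init b) := by
  rw [purifiedState, fullRefl_evolve (slotPoint_slotXor hS), fullRefl_fullRefl]

theorem nrm_emptyDB_init (A : Adversary lam q rounds S Z Out) :
    nrm (emptyDB (I := S') (Y := Bits lam) fun b => A.init b) = 1 := by
  rw [nrm_emptyDB]
  exact A.norm_init

theorem compressedState_bound (A : Adversary lam q rounds S Z Out) (hS : S ⊆ S')
    {edge : Bits lam → S' → Prop} {m : ℕ} (hm : ∀ x, {y | edge y x}.ncard ≤ m) :
    nrm (fullRefl (purifiedState A hS)) = 1 ∧
    nrm ({p | ∃ v, IsWalk edge p.1 (rounds + 1) v}.indicator (fullRefl (purifiedState A hS))) ≤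
      q * (2 * √(2 * (q * m : ℕ) / 2 ^ lam)) := by
  classical
  have h := evolve_compQuery_walk_bound (xs := slotPoint (Z := Z) hS) slotXor_slotXor
    (slotPoint_slotXor hS) hm (emptyDB fun b => A.init b) (fun p hp x => by
      by_contra hx
      exact hp (if_neg fun h => hx (h x))) rounds A.width A.total_width_le A.U
  rw [← fullRefl_purifiedState, nrm_emptyDB_init] at h
  refine ⟨h.1, h.2.2.trans ?_⟩
  have e : (Fintype.card (Bits lam) : ℝ) = 2 ^ lam := by simp
  rw [e, mul_one]
  gcongr
  exact A.total_width_le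

theorem nrm_purifiedState (A : Adversary lam q rounds S Z Out) (hS : S ⊆ S') :
    nrm (purifiedState A hS) = 1 := by
  rw [← nrm_fullRefl]
  exact (compressedState_bound A hS (edge := fun _ _ => False) (m := 0) (by simp)).1

theorem finalState_congr (A : Adversary lam q rounds S Z Out) {H H' : HashFun lam}
    (h : ∀ s ∈ S, H s = H' s) : A.finalState H = A.finalState H' := by
  have : ∀ k (ψ : StateSpace lam q S Z), parallelQuery H k ψ = parallelQuery H' k ψ := by
    intro k ψ
    ext b
    have e : queryBasis H k b = queryBasis H' k b :=
      Prod.ext (funext fun j => by simp only [queryBasis, h _ (b.1 j).1.2]) rfl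
    rw [parallelQuery_apply, parallelQuery_apply, e]
  simp only [Adversary.finalState, this]

/-- The squared amplitude of each function in the superposition is its probability under the oracle,
so averaging over `H` is a measurement of the purified state. -/
theorem successProb_le (A : Adversary lam q rounds S Z Out) (hS : S ⊆ S')
    (E : HashFun lam → Set Out)
    (hE : ∀ b H, A.out b ∈ E H ↔ A.out b ∈ E (extHash (S'.restrict H)))
    (W : Basis lam q S Z → Set (S' → Option (Bits lam)))
    (hW : ∀ b h, A.out b ∈ E (extHash h) → (fun x => some (h x)) ∈ W b) :
    A.successProb E ≤ ∑ b, nrm ((W b).indicator fun D => purifiedState A hS (D, b)) ^ 2 := by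
  classical
  have hfin : ∀ H : HashFun lam, A.finalState H = A.finalState (extHash (S'.restrict H)) :=
    fun H => finalState_congr A fun s hs => (extHash_apply (S'.restrict H) ⟨s, hS hs⟩).symm
  rw [Adversary.successProb, integral_randomOracle S' _ fun H => by
    simp only [Adversary.outputProb, ← hfin, ← hE]]
  simp only [Adversary.outputProb, Finset.mul_sum]
  rw [Finset.sum_comm]
  refine Finset.sum_le_sum fun b _ => ?_
  let φ : (S' → Bits lam) ↪ (S' → Option (Bits lam)) :=
    ⟨fun h x => some (h x), fun h h' e => funext fun x => Option.some_injective _ (congrFun e x)⟩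
  rw [nrm_sq]
  calc _ ≤ ∑ h, ‖(W b).indicator (fun D => purifiedState A hS (D, b)) (φ h)‖ ^ 2 := by
        refine Finset.sum_le_sum fun h _ => ?_
        split_ifs with hb
        · rw [show φ h = fun x => some (h x) from rfl, Set.indicator_of_mem (hW b h hb)]
          refine le_of_eq ?_
          rw [purifiedState_apply, norm_mul, norm_pow, Complex.norm_real, mul_pow, ← pow_mul,
            mul_comm S'.card, pow_mul, Real.norm_eq_abs, sq_abs, inv_pow (√_) 2,
            Real.sq_sqrt (Nat.cast_nonneg _)]
        · simp
    _ = ∑ D ∈ Finset.univ.map φ,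
        ‖(W b).indicator (fun D => purifiedState A hS (D, b)) D‖ ^ 2 := by rw [Finset.sum_map]
    _ ≤ _ := Finset.sum_le_sum_of_subset_of_nonneg (Finset.subset_univ _)
        fun _ _ _ => by positivity

theorem sum_nrm_slice_sq {I Y β : Type*} [Fintype I] [DecidableEq I] [Fintype Y] [Fintype β]
    (s : Set (I → Option Y)) (f : (I → Option Y) × β → ℂ) :
    ∑ b, nrm (s.indicator fun D => f (D, b)) ^ 2 = nrm ({p | p.1 ∈ s}.indicator f) ^ 2 := by
  simp only [nrm_sq]
  rw [Fintype.sum_prod_type_right]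
  rfl

theorem successProb_le_one (A : Adversary lam q rounds S Z Out) (E : HashFun lam → Set Out)
    (hE : ∀ b H, A.out b ∈ E H ↔ A.out b ∈ E (extHash (S'.restrict H))) (hS : S ⊆ S') :
    A.successProb E ≤ 1 := by
  have h := successProb_le A hS E hE (fun _ => Set.univ) fun _ _ _ => trivial
  rw [sum_nrm_slice_sq] at h
  simpa [nrm_purifiedState] using h

/-- A substring is determined by its starting position, which is below `v.length` because `lam` is
positive; the empty word in an empty string would break the count. -/
theorem ncard_substring_le (hlam : lam ≠ 0) (v : List Bool) :
    {y : Bits lam | Substring (List.ofFn y) v}.ncard ≤ v.length := by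
  classical
  have hsub : {y : Bits lam | Substring (List.ofFn y) v} ⊆
      (((Finset.range v.length).image fun i => fun j : Fin lam => (v.drop i).getD j false :
        Finset (Bits lam)) : Set (Bits lam)) := by
    rintro y ⟨a, b, hv⟩
    simp only [Finset.coe_image, Finset.coe_range, Set.mem_image, Set.mem_Iio]
    refine ⟨a.length, by rw [hv]; simp; omega, ?_⟩
    funext j
    rw [hv]
    simp [List.getElem?_append_left]
  refine (Set.ncard_le_ncard hsub (Set.toFinite _)).trans ?_
  rw [Set.ncard_coe_finset]
  exact Finset.card_image_le.trans (Finset.card_range _).le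

end Success

/-! ### Winning outputs as walks -/

section HSeq

variable {lam N : ℕ} {S' : Finset (List Bool)} (δ : ℝ)

/-- A hash value is contained in a string of admissible length. -/
def HSeqEdge (y : Bits lam) (x : S') : Prop :=
  ((x : List Bool).length : ℝ) ≤ δ * lam ∧ Substring (List.ofFn y) x

/-- Databases for which the output `o` is winning. -/
def winningDBs (o : (Fin (N + 1) → List Bool) × (Fin N → Bits lam)) (px : Fin (N + 1) → S') :
    Set (S' → Option (Bits lam)) :=
  {D | (∀ i, ((o.1 i).length : ℝ) ≤ δ * lam) ∧ (∀ i : Fin N, D (px i.castSucc) = some (o.2 i)) ∧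
    ∀ i : Fin N, Substring (List.ofFn (o.2 i)) (o.1 i.succ)}

variable {δ}

theorem ncard_hSeqEdge_le (hlam : lam ≠ 0) (x : S') :
    {y : Bits lam | HSeqEdge δ y x}.ncard ≤ ⌊δ * lam⌋₊ := by
  by_cases hx : ((x : List Bool).length : ℝ) ≤ δ * lam
  · refine (Set.ncard_le_ncard (fun y hy => hy.2) (Set.toFinite _)).trans
      ((ncard_substring_le hlam x).trans (Nat.le_floor hx))
  · simp [HSeqEdge, hx]

/-- The walk ends at x_{N-1}, as x_N need not be hashed. Reduction of the index modulo N + 1 plays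
no role below N. -/
theorem isWalk_of_mem_winningDBs {o : (Fin (N + 1) → List Bool) × (Fin N → Bits lam)}
    {px : Fin (N + 1) → S'} (hpx : ∀ i, (px i : List Bool) = o.1 i)
    {D : S' → Option (Bits lam)} (hD : D ∈ winningDBs δ o px) :
    IsWalk (HSeqEdge δ) D N fun i => px (Fin.ofNat (N + 1) i) := by
  obtain ⟨h1, h2, h3⟩ := hD
  have key : ∀ i (hi : i < N), Fin.ofNat (N + 1) i = (⟨i, hi⟩ : Fin N).castSucc := fun i hi => by
    ext; simp; omega
  have key' : ∀ i (hi : i < N), Fin.ofNat (N + 1) (i + 1) = (⟨i, hi⟩ : Fin N).succ :=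
    fun i hi => by ext; simp; omega
  refine ⟨fun i hi => ?_, fun i hi => ?_⟩
  · beta_reduce
    rw [key i hi, h2]
    exact Option.some_ne_none _
  refine ⟨o.2 ⟨i, by omega⟩, by beta_reduce; rw [key i (by omega), h2], ?_, ?_⟩
  · rw [hpx]; exact h1 _
  · rw [hpx, key' i (by omega)]; exact h3 _

theorem nrm_indicator_winningDBs_le {o : (Fin (N + 1) → List Bool) × (Fin N → Bits lam)}
    {px : Fin (N + 1) → S'} (hpx : ∀ i, (px i : List Bool) = o.1 i)
    (f : (S' → Option (Bits lam)) → ℂ) (hf : ∀ D x, D x = none → f D = 0) :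
    nrm ((winningDBs δ o px).indicator f) ^ 2 ≤
      2 * nrm ({D | ∃ v, IsWalk (HSeqEdge δ) D N v}.indicator (multiRefl Finset.univ f)) ^ 2 +
        2 * (N / 2 ^ lam) * nrm f ^ 2 := by
  classical
  rcases (winningDBs δ o px).eq_empty_or_nonempty with h | ⟨D₀, hD₀⟩
  · rw [h, Set.indicator_empty]
    have : nrm (fun _ : S' → Option (Bits lam) => (0 : ℂ)) = 0 := by
      rw [← sq_eq_zero_iff, nrm_sq]
      simp
    rw [this, zero_pow two_ne_zero]
    positivity
  set X : Finset S' := Finset.univ.image fun i : Fin N => px i.castSucc with hX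
  have hXc : X.card ≤ N := Finset.card_image_le.trans (by simp)
  -- A nonempty winning set is a cylinder. Prescribing the values through `D₀` handles repeated
  -- strings.
  have hs : winningDBs δ o px = {D | ∀ x ∈ X, D x = D₀ x} := by
    ext D
    simp only [hX, Finset.mem_image, Finset.mem_univ, true_and, Set.mem_ofPred_eq,
      forall_exists_index, forall_apply_eq_imp_iff, hD₀.2.1]
    exact ⟨fun h => h.2.1, fun h => ⟨hD₀.1, h, hD₀.2.2⟩⟩
  have h := sum_indicator_le_multiRefl D₀ X (by simp [hX, hD₀.2.1]) f fun x _ D => hf D x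
  rw [← hs] at h
  refine h.trans ?_
  have h1 : nrm ((winningDBs δ o px).indicator (multiRefl Finset.univ f)) ≤
      nrm ({D | ∃ v, IsWalk (HSeqEdge δ) D N v}.indicator (multiRefl Finset.univ f)) :=
    nrm_le_of_norm_le fun D => norm_indicator_le_of_subset
      (show winningDBs δ o px ⊆ {D | ∃ v, IsWalk (HSeqEdge δ) D N v} from
        fun D hD => ⟨_, isWalk_of_mem_winningDBs hpx hD⟩) _ _
  have e : (Fintype.card (Bits lam) : ℝ) = 2 ^ lam := by simp
  rw [e]
  have := nrm_nonneg ((winningDBs δ o px).indicator (multiRefl Finset.univ f))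
  gcongr

end HSeq

end PQROM

theorem mainTheorem1 (lam q N : ℕ) (hN : 1 ≤ N) (δ : ℝ) (hδ : 1 ≤ δ)
    (S : Finset (List Bool)) {Z : Type*} [Fintype Z]
    (A : PQROM.Adversary lam q (N - 1) S Z
      ((Fin (N + 1) → List Bool) × (Fin N → PQROM.Bits lam))) :
    A.successProb (PQROM.HSeqOutputs lam N δ) ≤
      64 * (q : ℝ) ^ 3 * δ * lam / 2 ^ lam + 2 * N / 2 ^ lam := by
  classical
  -- Output strings are added because they need not fit into the query registers.
  let S' : Finset (List Bool) := S ∪ Finset.univ.biUnion fun b => Finset.univ.image (A.out b).1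
  have hS : S ⊆ S' := Finset.subset_union_left
  have hout : ∀ b i, (A.out b).1 i ∈ S' := fun b i =>
    Finset.mem_union_right _ (Finset.mem_biUnion.2
      ⟨b, Finset.mem_univ _, Finset.mem_image_of_mem _ (Finset.mem_univ i)⟩)
  let px : ∀ b, Fin (N + 1) → S' := fun b i => ⟨(A.out b).1 i, hout b i⟩
  have hE : ∀ b H, A.out b ∈ PQROM.HSeqOutputs lam N δ H ↔
      A.out b ∈ PQROM.HSeqOutputs lam N δ (PQROM.extHash (S'.restrict H)) := by
    intro b H
    have : ∀ i, PQROM.extHash (S'.restrict H) ((A.out b).1 i) = H ((A.out b).1 i) :=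
      fun i => PQROM.extHash_apply (S'.restrict H) (px b i)
    simp only [PQROM.HSeqOutputs, Set.mem_ofPred_eq, this]
  have hN' : (1 : ℝ) ≤ N := by exact_mod_cast hN
  rcases eq_or_ne lam 0 with hlam | hlam
  -- For λ = 0 the claimed bound is 2N ≥ 1.
  · refine (PQROM.successProb_le_one A _ hE hS).trans ?_
    subst hlam
    simp
    linarith
  set Ψ := PQROM.purifiedState A hS with hΨ
  set m := ⌊δ * lam⌋₊ with hm
  have hmle : (m : ℝ) ≤ δ * lam := Nat.floor_le (by positivity)
  obtain ⟨-, hbad⟩ := PQROM.compressedState_bound A hS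
    (edge := PQROM.HSeqEdge δ) (PQROM.ncard_hSeqEdge_le hlam)
  rw [Nat.sub_add_cancel hN, ← hΨ, ← hm] at hbad
  set a := PQROM.nrm ({p | ∃ v, PQROM.IsWalk (PQROM.HSeqEdge δ) p.1 N v}.indicator
    (PQROM.fullRefl Ψ)) with ha
  have ha0 : 0 ≤ a := PQROM.nrm_nonneg _
  have ha2 : a ^ 2 ≤ 8 * q ^ 3 * m / 2 ^ lam := by
    calc a ^ 2 ≤ (q * (2 * √(2 * (q * m : ℕ) / 2 ^ lam))) ^ 2 := by gcongr
      _ = _ := by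
        rw [mul_pow, mul_pow, Real.sq_sqrt (by positivity)]
        push_cast
        ring
  have h1 := PQROM.successProb_le A hS (PQROM.HSeqOutputs lam N δ) hE
    (fun b => PQROM.winningDBs δ (A.out b) (px b)) (fun b h hb => by
      refine ⟨hb.1, fun i => ?_, hb.2.2⟩
      rw [hb.2.1 i]
      exact congrArg some (PQROM.extHash_apply h (px b i.castSucc)).symm)
  have h2 : A.successProb (PQROM.HSeqOutputs lam N δ) ≤ 2 * a ^ 2 + 2 * (N / 2 ^ lam) := by
    refine h1.trans ((Finset.sum_le_sum fun b _ =>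
      PQROM.nrm_indicator_winningDBs_le (px := px b) (fun i => rfl) _
        fun D x hx => PQROM.purifiedState_eq_zero A hS hx b).trans (le_of_eq ?_))
    rw [Finset.sum_add_distrib, ← Finset.mul_sum, ← Finset.mul_sum]
    have e1 := PQROM.sum_nrm_slice_sq
      {D | ∃ v, PQROM.IsWalk (PQROM.HSeqEdge δ) D N v} (PQROM.fullRefl Ψ)
    have e2 := PQROM.sum_nrm_slice_sq Set.univ Ψ
    simp only [Set.indicator_univ, Set.mem_univ, Set.ofPred_true] at e2
    rw [hΨ, PQROM.nrm_purifiedState, one_pow, ← hΨ] at e2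
    rw [e2, mul_one]
    congr 2
  refine h2.trans ?_
  -- Only 16 of the constant 64 is needed.
  have h3 : 2 * (8 * q ^ 3 * m / 2 ^ lam : ℝ) ≤ 64 * (q : ℝ) ^ 3 * δ * lam / 2 ^ lam := by
    rw [← mul_div_assoc]
    refine div_le_div_of_nonneg_right ?_ (by positivity)
    have : (q : ℝ) ^ 3 * m ≤ q ^ 3 * (δ * lam) := by gcongr
    have h0 : 0 ≤ (q : ℝ) ^ 3 * (δ * lam) := by positivity
    linarith
  rw [mul_div_assoc 2 (N : ℝ)]
  linarith
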